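/- **Model.** The state of nature is $\theta\in\{H,L\}$ with $\Pr(\theta=H)=p\in(0,1)$. Signals lie in a finite set $S$; conditional on $\theta$ they are i.i.d. with law $\pi_\theta$, where $\pi_\theta(s)>0$ for all $s,\theta$, and $\pi_H\neq\pi_L$. Put $$\gamma=\frac{\max_{s}\pi_H(s)/\pi_L(s)}{\min_{s}\pi_H(s)/\pi_L(s)},\qquad \kappa=\max\Bigl\{\frac{p}{1-p},\frac{1-p}{p}\Bigr\}.$$ Let $m\ge 2$ and $M=\{1,\dots,m\}$ (memory states). A protocol is a triple $\Pi=(f,g,a)$ with $f:M\times S\to\Delta(M)$, $g\in\Delta(M)$, $a:M\to[0,1]$. The receiver commits to $\Pi$; the sender, knowing $\Pi$ and $\theta$, chooses a strategy $\sigma:M\times\{H,L\}\to[0,1]$. The initial memory state $m_0$ is drawn from $g$. In each period $t=0,1,2,\dots$ the game ends in $m_t$ if $m_t$ is absorbing (that is, $f(m_t,s)(m_t)=1$ for all $s\in S$); otherwise the sender stops, and the game ends in $m_t$, with probability $\sigma(m_t,\theta)$; otherwise a signal $s_t\sim\pi_\theta$ is generated and $m_{t+1}$ is drawn from $f(m_t,s_t)$.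 If the game ends in $i$, action $H$ is taken with probability $a(i)$ and action $L$ otherwise. The receiver gets $1$ if the action equals $\theta$ and $0$ otherwise; the sender gets $1$ if the action is $H$ and $0$ otherwise; both get $0$ if the game never ends. Let $U^R(\Pi,\sigma)$ and $U^S(\Pi,\sigma)$ be the expected payoffs and $\mathrm{br}(\Pi)=\arg\max_\sigma U^S(\Pi,\sigma)$. **Theorem.** For every protocol $\Pi$ with $m$ memory states, $\mathrm{br}(\Pi)\neq\varnothing$, and $$\sup_\Pi\sup_{\sigma\in \mathrm{br}(\Pi)}U^R(\Pi,\sigma)=\sup_\Pi\inf_{\sigma\in \mathrm{br}(\Pi)}U^R(\Pi,\sigma)=V,$$ where the suprema over $\Pi$ are over all protocols with $m$ memory states and $$V=\begin{cases}1-\dfrac{2\sqrt{p(1-p)\gamma^{m-2}}-1}{\gamma^{m-2}-1},&\text{if }\gamma^{m-2}>\kappa,\\[1.2em]\max\{p,1-p\},&\text{otherwise.}\end{cases}$$ Furthermore, if $m\ge4$ and $\gamma^{m-2}>\kappa$, the value is not attained: for no protocol $\Pi$ with $m$ memory states is $V$ equal to $\sup_{\sigma\in \mathrm{br}(\Pi)}U^R(\Pi,\sigma)$,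 to $\inf_{\sigma\in \mathrm{br}(\Pi)}U^R(\Pi,\sigma)$, or to $U^R(\Pi,\sigma)$ for some $\sigma\in\mathrm{br}(\Pi)$. -/

import Mathlib

noncomputable section

namespace StrategicMemory

/-- The two states of nature. -/
inductive Nature : Type where
  | H : Nature
  | L : Nature

/-- A signal-generating process on a finite signal set `S`: for each state of nature a probability
distribution with full support, the two distributions being different. -/
structure Experiment (S : Type*) [Fintype S] where
  prob : Nature → S → ℝ
  prob_pos : ∀ θ s, 0 < prob θ s
  prob_sum : ∀ θ, ∑ s, prob θ s = 1
  informative : prob Nature.H ≠ prob Nature.L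

/-- The likelihood ratio of a signal. -/
def Experiment.ratio {S : Type*} [Fintype S] (E : Experiment S) (s : S) : ℝ :=
  E.prob Nature.H s / E.prob Nature.L s

/-- The spread `γ`: the largest likelihood ratio divided by the smallest one
(`S` is finite, and nonempty because the probabilities sum to one). -/
def Experiment.gamma {S : Type*} [Fintype S] (E : Experiment S) : ℝ :=
  (⨆ s, E.ratio s) / (⨅ s, E.ratio s)

/-- The skewness `κ` of the prior `p = Pr(θ = H)`. -/
def skewness (p : ℝ) : ℝ := max (p / (1 - p)) ((1 - p) / p)

/-- A protocol with set of memory states `M`: transition function, initial distribution, and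
probability `a i` of taking action `H` when the game ends in memory state `i`. -/
structure Protocol (S M : Type*) [Fintype M] where
  f : M → S → stdSimplex ℝ M
  g : stdSimplex ℝ M
  a : M → unitInterval

/-- A strategy of the sender: the probability of stopping, given the current memory state and the
state of nature. -/
abbrev Strategy (M : Type*) : Type _ := M → Nature → unitInterval

section Play

variable {S M : Type*} [Fintype M]

/-- The memory state `i` does not update in response to any signal. -/
def Protocol.Absorbing (P : Protocol S M) (i : M) : Prop :=
  ∀ s, (P.f i s).1 i = 1

open Classical in
/-- The probability that the game ends in a period that begins in memory state `i`. -/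
def endRate (P : Protocol S M) (σ : Strategy M) (θ : Nature) (i : M) : ℝ :=
  if P.Absorbing i then 1 else (σ i θ : ℝ)

theorem endRate_nonneg (P : Protocol S M) (σ : Strategy M) (θ : Nature) (i : M) :
    0 ≤ endRate P σ θ i := by
  unfold endRate
  split_ifs
  · exact zero_le_one
  · exact (σ i θ).2.1

theorem endRate_le_one (P : Protocol S M) (σ : Strategy M) (θ : Nature) (i : M) :
    endRate P σ θ i ≤ 1 := by
  unfold endRate
  split_ifs
  · exact le_rfl
  · exact (σ i θ).2.2

variable [Fintype S]

/-- The probability that the memory state moves from `i` to `j` when a signal is generated. -/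
def transition (E : Experiment S) (P : Protocol S M) (θ : Nature) (i j : M) : ℝ :=
  ∑ s, E.prob θ s * (P.f i s).1 j

/-- The probability, conditional on `θ`, that the game has not ended before period `t` and that
the memory state at the beginning of period `t` is `j`. -/
def activeProb (E : Experiment S) (P : Protocol S M) (σ : Strategy M) (θ : Nature) : ℕ → M → ℝ
  | 0, j => P.g.1 j
  | t + 1, j => ∑ i, activeProb E P σ θ t i * (1 - endRate P σ θ i) * transition E P θ i j

/-- The probability, conditional on `θ`, that the game ends (in some period) in memory state `i`.
The series converges by `summable_activeProb_mul_endRate`. -/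
def endProb (E : Experiment S) (P : Protocol S M) (σ : Strategy M) (θ : Nature) (i : M) : ℝ :=
  ∑' t, activeProb E P σ θ t i * endRate P σ θ i

/-- The sender's expected payoff: the probability that action `H` is taken
(nothing is gained if the game never ends). -/
def senderPayoff (E : Experiment S) (p : ℝ) (P : Protocol S M) (σ : Strategy M) : ℝ :=
  p * ∑ i, endProb E P σ Nature.H i * (P.a i : ℝ)
    + (1 - p) * ∑ i, endProb E P σ Nature.L i * (P.a i : ℝ)

/-- The receiver's expected payoff: the probability that an action is taken that matches the state
of nature (nothing is gained if the game never ends). -/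
def receiverPayoff (E : Experiment S) (p : ℝ) (P : Protocol S M) (σ : Strategy M) : ℝ :=
  p * ∑ i, endProb E P σ Nature.H i * (P.a i : ℝ)
    + (1 - p) * ∑ i, endProb E P σ Nature.L i * (1 - (P.a i : ℝ))

/-- The sender's best responses to a protocol. -/
def bestResponses (E : Experiment S) (p : ℝ) (P : Protocol S M) : Set (Strategy M) :=
  {σ | ∀ σ', senderPayoff E p P σ' ≤ senderPayoff E p P σ}

/-- The receiver's payoffs from a protocol when the sender plays a best response to it. -/
def receiverPayoffs (E : Experiment S) (p : ℝ) (P : Protocol S M) : Set ℝ :=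
  receiverPayoff E p P '' bestResponses E p P

theorem transition_nonneg (E : Experiment S) (P : Protocol S M) (θ : Nature) (i j : M) :
    0 ≤ transition E P θ i j :=
  Finset.sum_nonneg fun s _ => mul_nonneg (E.prob_pos θ s).le ((P.f i s).2.1 j)

theorem transition_sum (E : Experiment S) (P : Protocol S M) (θ : Nature) (i : M) :
    ∑ j, transition E P θ i j = 1 := by
  unfold transition
  rw [Finset.sum_comm]
  simp_rw [← Finset.mul_sum, (P.f i _).2.2, mul_one, E.prob_sum]

theorem activeProb_nonneg (E : Experiment S) (P : Protocol S M) (σ : Strategy M) (θ : Nature)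
    (t : ℕ) (i : M) : 0 ≤ activeProb E P σ θ t i := by
  induction t generalizing i with
  | zero => exact P.g.2.1 i
  | succ t ih =>
    exact Finset.sum_nonneg fun j _ => mul_nonneg
      (mul_nonneg (ih j) (sub_nonneg.2 (endRate_le_one P σ θ j))) (transition_nonneg E P θ j i)

/-- Conservation of probability: up to any period, the game has ended or is active. -/
theorem sum_ended_add_active (E : Experiment S) (P : Protocol S M) (σ : Strategy M) (θ : Nature)
    (n : ℕ) :
    ∑ t ∈ Finset.range n, ∑ i, activeProb E P σ θ t i * endRate P σ θ i
      + ∑ i, activeProb E P σ θ n i = 1 := by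
  induction n with
  | zero => simpa [activeProb] using P.g.2.2
  | succ n ih =>
    have h : ∑ j, activeProb E P σ θ (n + 1) j
        = ∑ i, activeProb E P σ θ n i * (1 - endRate P σ θ i) := by
      simp only [activeProb]
      rw [Finset.sum_comm]
      simp_rw [← Finset.mul_sum, transition_sum, mul_one]
    have h' : ∑ i, activeProb E P σ θ n i * endRate P σ θ i
        + ∑ i, activeProb E P σ θ n i * (1 - endRate P σ θ i) = ∑ i, activeProb E P σ θ n i := by
      rw [← Finset.sum_add_distrib]
      exact Finset.sum_congr rfl fun i _ => by ring
    rw [Finset.sum_range_succ, h]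
    linarith

theorem summable_activeProb_mul_endRate (E : Experiment S) (P : Protocol S M) (σ : Strategy M)
    (θ : Nature) (i : M) : Summable fun t => activeProb E P σ θ t i * endRate P σ θ i := by
  have h0 : ∀ t j, 0 ≤ activeProb E P σ θ t j * endRate P σ θ j := fun t j =>
    mul_nonneg (activeProb_nonneg E P σ θ t j) (endRate_nonneg P σ θ j)
  refine summable_of_sum_range_le (c := 1) (fun t => h0 t i) fun n => ?_
  have h1 := sum_ended_add_active E P σ θ n
  have h2 : 0 ≤ ∑ j, activeProb E P σ θ n j :=
    Finset.sum_nonneg fun j _ => activeProb_nonneg E P σ θ n j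
  have h3 : ∑ t ∈ Finset.range n, activeProb E P σ θ t i * endRate P σ θ i
      ≤ ∑ t ∈ Finset.range n, ∑ j, activeProb E P σ θ t j * endRate P σ θ j :=
    Finset.sum_le_sum fun t _ => Finset.single_le_sum (fun j _ => h0 t j) (Finset.mem_univ i)
  linarith

end Play

/-- The closed form of the receiver's optimal payoff with `m` memory states. -/
def optimalPayoff (p γ : ℝ) (m : ℕ) : ℝ :=
  if γ ^ (m - 2) > skewness p then
    1 - (2 * √(p * (1 - p) * γ ^ (m - 2)) - 1) / (γ ^ (m - 2) - 1)
  else max p (1 - p)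

end StrategicMemory

end

/-! The sender observes the state of nature, so each state gives a separate optimal stopping problem
for a finite Markov chain with reward `a`; its value is the least superharmonic majorant of `a`
(`IsStochastic.exists_isValue`). Stopping where value and reward agree is optimal, and every best
response earns the value in both states.

Upper bound. Let `D` be the optimal stopping set in state `H`, and let `x` be the value there. In
state `L` the sender could also stop on `D`, earning some `y` not above the value in `L`; a larger
sender payoff in `L` only hurts the receiver, who therefore gets at most `p * x + (1 - p) * (1 -
y)`. Now `x` and `y` are harmonic extensions of the same data from the same `D`, for matrices whose
entries differ by factors between the extreme likelihood ratios. Replacing a single row multiplies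
the odds by at most `γ`, as one sees by cutting paths at visits to that row's state
(`row_change_odds`). If `D` has two states, at most `m - 2` rows count; if it has one, `x = y`. So
the odds differ by at most `γ ^ (m - 2)` (`exists_odds_bound`), and AM-GM turns this into the closed
form (`two_sqrt_le`).

Lower bound. A gambler's ruin chain with absorbing ends, up-moves on the highest likelihood ratio,
down-moves on the lowest and exit probabilities of order `δ` has odds ratio tending to `γ ^ (m - 2)`
as `δ → 0` (`exists_ruin_payoff`, `tendsto_ruinSum`). It ends almost surely under every strategy, so
all best responses pay the receiver the same.

Non-attainment. Equality of odds would require that, from the initial state, every state outside `D`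
is visited before stopping, and that each such state has successors committed to either action until
its next visit. Two states outside `D` make this impossible (`not_separating`). -/

open Filter Topology

namespace StrategicMemory

/-! ### Dirichlet problems for finite chains, and the effect of changing one row -/

section Dirichlet

variable {M : Type*} [Fintype M]

/-- A stochastic matrix on a finite set. -/
structure IsStochastic (P : M → M → ℝ) : Prop where
  nonneg : ∀ i j, 0 ≤ P i j
  sum_eq_one : ∀ i, ∑ j, P i j = 1

/-- Every nonempty set disjoint from `D` has an outgoing transition; for a finite chain this says
that `D` is reached from everywhere. -/
def Escapes (P : M → M → ℝ) (D : Set M) : Prop :=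
  ∀ T : Set M, T.Nonempty → Disjoint T D → ∃ i ∈ T, ∃ j ∉ T, 0 < P i j

/-- `u` is the harmonic extension of `a` from `D`. -/
structure IsHarmonicExt (P : M → M → ℝ) (D : Set M) (a u : M → ℝ) : Prop where
  boundary : ∀ i ∈ D, u i = a i
  harmonic : ∀ i ∉ D, ∑ j, P i j * u j = u i

theorem Escapes.mono {M : Type*} {P : M → M → ℝ} {D D' : Set M} (h : Escapes P D) (hD : D ⊆ D') :
    Escapes P D' :=
  fun T hT hd => h T hT (hd.mono_right hD)

/-- A set disjoint from `D` only sees rows outside `D`, so supports matter only there. This carries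
escape over between hybrid matrices and between the two states of nature. -/
theorem Escapes.of_support {M : Type*} {P P' : M → M → ℝ} {D : Set M} (h : Escapes P D)
    (hP : ∀ i ∉ D, ∀ j, 0 < P i j → 0 < P' i j) : Escapes P' D := by
  intro T hT hd
  obtain ⟨i, hi, j, hj, hij⟩ := h T hT hd
  exact ⟨i, hi, j, hj, hP i (Set.disjoint_left.1 hd hi) j hij⟩

/-- The minimum principle for superharmonic functions. -/
theorem IsStochastic.nonneg_of_superharmonic {P : M → M → ℝ} {D : Set M} (hP : IsStochastic P)
    (hD : Escapes P D) {u : M → ℝ} (hb : ∀ i ∈ D, 0 ≤ u i)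
    (hu : ∀ i ∉ D, ∑ j, P i j * u j ≤ u i) (i : M) : 0 ≤ u i := by
  obtain ⟨i₀, -, hmin⟩ := Finset.exists_min_image Finset.univ u ⟨i, Finset.mem_univ i⟩
  by_contra! hi
  have hneg : u i₀ < 0 := (hmin i (Finset.mem_univ i)).trans_lt hi
  -- A negative minimum is not attained on `D`, so some row leaves the set of minimizers; its
  -- average then exceeds the minimum, against superharmonicity.
  obtain ⟨k, hk, j, hj, hkj⟩ := hD {j | u j = u i₀} ⟨i₀, rfl⟩
    (Set.disjoint_left.2 fun j hj hjD => by
      have := hb j hjD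
      rw [Set.mem_ofPred_eq] at hj
      linarith)
  have hk' : u k = u i₀ := hk
  have hkD : k ∉ D := fun h => by have := hb k h; linarith
  have hlt : ∑ l, P k l * u i₀ < ∑ l, P k l * u l := by
    refine Finset.sum_lt_sum
      (fun l _ => mul_le_mul_of_nonneg_left (hmin l (Finset.mem_univ l)) (hP.nonneg k l))
      ⟨j, Finset.mem_univ j, mul_lt_mul_of_pos_left ?_ hkj⟩
    exact lt_of_le_of_ne (hmin j (Finset.mem_univ j)) fun h => hj h.symm
  rw [← Finset.sum_mul, hP.sum_eq_one, one_mul] at hlt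
  have := hu k hkD
  linarith

open Classical in
/-- The Dirichlet problem with source term is solvable. -/
theorem IsStochastic.exists_dirichlet {P : M → M → ℝ} {D : Set M} (hP : IsStochastic P)
    (hD : Escapes P D) (b : M → ℝ) :
    ∃ u : M → ℝ, (∀ i ∈ D, u i = b i) ∧ ∀ i ∉ D, u i = b i + ∑ j, P i j * u j := by
  let T : (M → ℝ) →ₗ[ℝ] (M → ℝ) :=
    { toFun := fun u i => u i - if i ∈ D then 0 else ∑ j, P i j * u j
      map_add' := fun u v => by
        funext i
        by_cases hi : i ∈ D
        · simp [hi]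
        · simp only [hi, Pi.add_apply, mul_add, Finset.sum_add_distrib, if_false]
          ring
      map_smul' := fun c u => by
        funext i
        by_cases hi : i ∈ D
        · simp [hi]
        · have : ∑ j, P i j * (c * u j) = c * ∑ j, P i j * u j := by
            rw [Finset.mul_sum]
            exact Finset.sum_congr rfl fun j _ => by ring
          simp only [hi, Pi.smul_apply, smul_eq_mul, if_false, RingHom.id_apply, this]
          ring }
  -- The system is square, so existence follows from uniqueness, which is the minimum principle for
  -- `u` and `-u`.
  have hT : Function.Injective T := by
    rw [← LinearMap.ker_eq_bot, LinearMap.ker_eq_bot']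
    intro u hu
    have hu' : ∀ i, u i - (if i ∈ D then 0 else ∑ j, P i j * u j) = 0 := fun i => congrFun hu i
    have h1 : ∀ i ∈ D, u i = 0 := fun i hi => by simpa [hi] using hu' i
    have h2 : ∀ i ∉ D, ∑ j, P i j * u j = u i := fun i hi => by
      have := hu' i
      rw [if_neg hi] at this
      linarith
    funext i
    refine le_antisymm ?_ (hP.nonneg_of_superharmonic hD (fun i hi => (h1 i hi).ge)
      (fun i hi => (h2 i hi).le) i)
    have := hP.nonneg_of_superharmonic hD (u := fun i => - u i)
      (fun i hi => by simp [h1 i hi]) (fun i hi => by simp [h2 i hi]) i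
    simpa using this
  obtain ⟨u, hu⟩ := LinearMap.injective_iff_surjective.1 hT b
  have hu' : ∀ i, u i - (if i ∈ D then 0 else ∑ j, P i j * u j) = b i := fun i => congrFun hu i
  refine ⟨u, fun i hi => by simpa [hi] using hu' i, fun i hi => ?_⟩
  have := hu' i
  rw [if_neg hi] at this
  linarith

open Classical in
theorem IsStochastic.exists_harmonicExt {P : M → M → ℝ} {D : Set M} (hP : IsStochastic P)
    (hD : Escapes P D) (a : M → ℝ) : ∃ u, IsHarmonicExt P D a u := by
  obtain ⟨u, h1, h2⟩ := hP.exists_dirichlet hD fun i => if i ∈ D then a i else 0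
  exact ⟨u, fun i hi => by simpa [hi] using h1 i hi, fun i hi => by simpa [hi] using (h2 i hi).symm⟩

theorem IsHarmonicExt.sub {P : M → M → ℝ} {D : Set M} {a b u v : M → ℝ}
    (hu : IsHarmonicExt P D a u) (hv : IsHarmonicExt P D b v) :
    IsHarmonicExt P D (fun i => a i - b i) (fun i => u i - v i) where
  boundary i hi := by rw [hu.boundary i hi, hv.boundary i hi]
  harmonic i hi := by
    simp only [mul_sub, Finset.sum_sub_distrib, hu.harmonic i hi, hv.harmonic i hi]

theorem IsHarmonicExt.add {P : M → M → ℝ} {D : Set M} {a b u v : M → ℝ}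
    (hu : IsHarmonicExt P D a u) (hv : IsHarmonicExt P D b v) :
    IsHarmonicExt P D (fun i => a i + b i) (fun i => u i + v i) where
  boundary i hi := by rw [hu.boundary i hi, hv.boundary i hi]
  harmonic i hi := by
    simp only [mul_add, Finset.sum_add_distrib, hu.harmonic i hi, hv.harmonic i hi]

theorem IsHarmonicExt.mul_const {P : M → M → ℝ} {D : Set M} {a u : M → ℝ}
    (hu : IsHarmonicExt P D a u) (c : ℝ) :
    IsHarmonicExt P D (fun i => a i * c) (fun i => u i * c) where
  boundary i hi := by rw [hu.boundary i hi]
  harmonic i hi := by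
    simp only [← mul_assoc, ← Finset.sum_mul, hu.harmonic i hi]

theorem IsStochastic.isHarmonicExt_const {P : M → M → ℝ} (hP : IsStochastic P) (D : Set M)
    (c : ℝ) : IsHarmonicExt P D (fun _ => c) (fun _ => c) where
  boundary _ _ := rfl
  harmonic i _ := by rw [← Finset.sum_mul, hP.sum_eq_one, one_mul]

theorem IsHarmonicExt.nonneg {P : M → M → ℝ} {D : Set M} {a u : M → ℝ}
    (hu : IsHarmonicExt P D a u) (hP : IsStochastic P) (hD : Escapes P D)
    (ha : ∀ i ∈ D, 0 ≤ a i) (i : M) : 0 ≤ u i :=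
  hP.nonneg_of_superharmonic hD (fun i hi => by rw [hu.boundary i hi]; exact ha i hi)
    (fun i hi => (hu.harmonic i hi).le) i

theorem IsHarmonicExt.mono {P : M → M → ℝ} {D : Set M} {a b u v : M → ℝ}
    (hu : IsHarmonicExt P D a u) (hv : IsHarmonicExt P D b v) (hP : IsStochastic P)
    (hD : Escapes P D) (hab : ∀ i ∈ D, a i ≤ b i) (i : M) : u i ≤ v i :=
  sub_nonneg.1 ((hv.sub hu).nonneg hP hD (fun i hi => sub_nonneg.2 (hab i hi)) i)

theorem IsHarmonicExt.unique {P : M → M → ℝ} {D : Set M} {a b u v : M → ℝ}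
    (hu : IsHarmonicExt P D a u) (hv : IsHarmonicExt P D b v) (hP : IsStochastic P)
    (hD : Escapes P D) (hab : ∀ i ∈ D, a i = b i) (i : M) : u i = v i :=
  le_antisymm (hu.mono hv hP hD (fun i hi => (hab i hi).le) i)
    (hv.mono hu hP hD (fun i hi => (hab i hi).ge) i)

theorem IsHarmonicExt.congr_matrix {P P' : M → M → ℝ} {D : Set M} {a u : M → ℝ}
    (hu : IsHarmonicExt P D a u) (h : ∀ i ∉ D, ∀ j, P i j = P' i j) : IsHarmonicExt P' D a u where
  boundary := hu.boundary
  harmonic i hi := by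
    rw [← hu.harmonic i hi]
    exact Finset.sum_congr rfl fun j _ => by rw [h i hi j]

/-- The payoff of `a` when the chain is stopped on `D` and killed at `k`. -/
structure IsKilledExt (P : M → M → ℝ) (D : Set M) (k : M) (a A : M → ℝ) : Prop where
  ext : IsHarmonicExt P (insert k D) A A
  boundary : ∀ i ∈ D, A i = a i
  killed : A k = 0

open Classical in
theorem IsStochastic.exists_killedExt {P : M → M → ℝ} {D : Set M} (hP : IsStochastic P)
    (hD : Escapes P D) {k : M} (hk : k ∉ D) (a : M → ℝ) : ∃ A, IsKilledExt P D k a A := by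
  obtain ⟨A, hA⟩ := hP.exists_harmonicExt (hD.mono (Set.subset_insert k D))
    fun i => if i = k then 0 else a i
  refine ⟨A, ⟨fun _ _ => rfl, hA.harmonic⟩, fun i hi => ?_, ?_⟩
  · rw [hA.boundary i (Set.mem_insert_of_mem k hi), if_neg fun h : i = k => hk (h ▸ hi)]
  · rw [hA.boundary k (Set.mem_insert k D), if_pos rfl]

theorem IsKilledExt.nonneg {P : M → M → ℝ} {D : Set M} {k : M} {a A : M → ℝ}
    (hA : IsKilledExt P D k a A) (hP : IsStochastic P) (hD : Escapes P D)
    (ha : ∀ i ∈ D, 0 ≤ a i) (i : M) : 0 ≤ A i := by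
  refine hA.ext.nonneg hP (hD.mono (Set.subset_insert k D)) ?_ i
  rintro i (rfl | hi)
  · exact hA.killed.ge
  · rw [hA.boundary i hi]; exact ha i hi

theorem IsKilledExt.congr_matrix {P P' : M → M → ℝ} {D : Set M} {k : M} {a A : M → ℝ}
    (hA : IsKilledExt P D k a A) (h : ∀ i ∉ D, i ≠ k → ∀ j, P i j = P' i j) :
    IsKilledExt P' D k a A :=
  ⟨hA.ext.congr_matrix fun i hi => h i (fun h' => hi (Or.inr h')) fun h' => hi (Or.inl h'),
    hA.boundary, hA.killed⟩

/-- Decomposition of a harmonic extension at the first visit to `k`. -/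
theorem IsHarmonicExt.eq_killed {P : M → M → ℝ} {D : Set M} {k : M} {a u A B : M → ℝ}
    (hu : IsHarmonicExt P D a u) (hP : IsStochastic P) (hD : Escapes P D)
    (hA : IsKilledExt P D k a A) (hB : IsKilledExt P D k (fun i => 1 - a i) B) (i : M) :
    u i = A i + (1 - A i - B i) * u k := by
  have h := (hA.ext.add ((((hP.isHarmonicExt_const (insert k D) 1).sub hA.ext).sub
    hB.ext).mul_const (u k)))
  have hu' : IsHarmonicExt P (insert k D) u u :=
    ⟨fun _ _ => rfl, fun i hi => hu.harmonic i fun h => hi (Or.inr h)⟩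
  refine hu'.unique h hP (hD.mono (Set.subset_insert k D)) ?_ i
  rintro i (rfl | hi)
  · simp [hA.killed, hB.killed]
  · rw [hA.boundary i hi, hB.boundary i hi, hu.boundary i hi]
    ring

/-- At the state `k` itself the decomposition is a linear equation for the value. -/
theorem IsHarmonicExt.mul_killed {P : M → M → ℝ} {D : Set M} {k : M} {a u A B : M → ℝ}
    (hu : IsHarmonicExt P D a u) (hP : IsStochastic P) (hD : Escapes P D) (hk : k ∉ D)
    (hA : IsKilledExt P D k a A) (hB : IsKilledExt P D k (fun i => 1 - a i) B) :
    u k * (∑ j, P k j * A j + ∑ j, P k j * B j) = ∑ j, P k j * A j := by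
  have h1 := hu.harmonic k hk
  have h2 : ∑ j, P k j * u j = ∑ j, P k j * A j
      + (∑ j, P k j - ∑ j, P k j * A j - ∑ j, P k j * B j) * u k := by
    rw [← Finset.sum_sub_distrib, ← Finset.sum_sub_distrib, Finset.sum_mul,
      ← Finset.sum_add_distrib]
    refine Finset.sum_congr rfl fun j _ => ?_
    rw [hu.eq_killed hP hD hA hB j]
    ring
  rw [hP.sum_eq_one] at h2
  linarith

/-- With positive probability the chain leaves `k` and is stopped before it returns. -/
theorem IsStochastic.killed_sum_pos {P : M → M → ℝ} {D : Set M} {k : M} {a A B : M → ℝ}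
    (hP : IsStochastic P) (hD : Escapes P D) (ha : ∀ i, 0 ≤ a i)
    (ha' : ∀ i, a i ≤ 1) (hA : IsKilledExt P D k a A)
    (hB : IsKilledExt P D k (fun i => 1 - a i) B) :
    0 < ∑ j, P k j * A j + ∑ j, P k j * B j := by
  have hA0 := hA.nonneg hP hD fun i _ => ha i
  have hB0 := hB.nonneg hP hD fun i _ => sub_nonneg.2 (ha' i)
  -- The set where `A + B` vanishes contains `k` and misses `D`. A row leaving it must be row `k`,
  -- because elsewhere harmonicity would make `A i + B i` positive.
  obtain ⟨i, hi, j, hj, hij⟩ := hD {j | A j + B j = 0} ⟨k, by simp [hA.killed, hB.killed]⟩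
    (Set.disjoint_left.2 fun j hj hjD => by
      rw [Set.mem_ofPred_eq, hA.boundary j hjD, hB.boundary j hjD] at hj
      linarith)
  have hjpos : 0 < A j + B j := lt_of_le_of_ne (add_nonneg (hA0 j) (hB0 j)) fun h => hj h.symm
  have hpos : 0 < ∑ l, P i l * A l + ∑ l, P i l * B l := by
    rw [← Finset.sum_add_distrib]
    simp_rw [← mul_add]
    exact Finset.sum_pos'
      (fun l _ => mul_nonneg (hP.nonneg i l) (add_nonneg (hA0 l) (hB0 l)))
      ⟨j, Finset.mem_univ j, mul_pos hij hjpos⟩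
  by_cases hik : i = k
  · rwa [hik] at hpos
  · have hi0 : A i + B i = 0 := hi
    have hiD : i ∉ insert k D := by
      rintro (h | h)
      · exact hik h
      · rw [hA.boundary i h, hB.boundary i h] at hi0
        linarith
    rw [hA.ext.harmonic i hiD, hB.ext.harmonic i hiD] at hpos
    linarith

/-- Effect on the two payoffs from `i` of changing only the row `k` of the matrix, up to a common
factor. -/
theorem row_change_scaled {P P' : M → M → ℝ} {D : Set M} {k : M} {a u u' A B : M → ℝ}
    (hP : IsStochastic P) (hP' : IsStochastic P') (hD : Escapes P D) (hD' : Escapes P' D)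
    (hk : k ∉ D) (hrow : ∀ i ∉ D, i ≠ k → ∀ j, P i j = P' i j)
    (hu : IsHarmonicExt P D a u) (hu' : IsHarmonicExt P' D a u')
    (hA : IsKilledExt P D k a A) (hB : IsKilledExt P D k (fun i => 1 - a i) B) (i : M) :
    (∑ j, P k j * A j + ∑ j, P k j * B j) * u i
      = ∑ j, P k j * (A i * (A j + B j) + (1 - A i - B i) * A j) ∧
    (∑ j, P k j * A j + ∑ j, P k j * B j) * (1 - u i)
      = ∑ j, P k j * (B i * (A j + B j) + (1 - A i - B i) * B j) ∧
    (∑ j, P' k j * A j + ∑ j, P' k j * B j) * u' i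
      = ∑ j, P' k j * (A i * (A j + B j) + (1 - A i - B i) * A j) ∧
    (∑ j, P' k j * A j + ∑ j, P' k j * B j) * (1 - u' i)
      = ∑ j, P' k j * (B i * (A j + B j) + (1 - A i - B i) * B j) := by
  have key : ∀ (w : M → ℝ) (x : ℝ), x * (∑ j, w j * A j + ∑ j, w j * B j) = ∑ j, w j * A j →
      (∑ j, w j * A j + ∑ j, w j * B j) * (A i + (1 - A i - B i) * x)
        = ∑ j, w j * (A i * (A j + B j) + (1 - A i - B i) * A j) ∧
      (∑ j, w j * A j + ∑ j, w j * B j) * (1 - (A i + (1 - A i - B i) * x))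
        = ∑ j, w j * (B i * (A j + B j) + (1 - A i - B i) * B j) := by
    intro w x hx
    have e1 : ∀ c d : ℝ, ∀ C : M → ℝ, ∑ j, w j * (c * (A j + B j) + d * C j)
        = c * (∑ j, w j * A j + ∑ j, w j * B j) + d * ∑ j, w j * C j := by
      intro c d C
      rw [← Finset.sum_add_distrib, Finset.mul_sum, Finset.mul_sum, ← Finset.sum_add_distrib]
      exact Finset.sum_congr rfl fun j _ => by ring
    rw [e1, e1]
    constructor
    · linear_combination (1 - A i - B i) * hx
    · linear_combination - (1 - A i - B i) * hx
  have hA' := hA.congr_matrix hrow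
  have hB' := hB.congr_matrix hrow
  rw [hu.eq_killed hP hD hA hB i, hu'.eq_killed hP' hD' hA' hB' i]
  have h1 := key (P k) (u k) (hu.mul_killed hP hD hk hA hB)
  have h2 := key (P' k) (u' k) (hu'.mul_killed hP' hD' hk hA' hB')
  exact ⟨h1.1, h1.2, h2.1, h2.2⟩

/-- Changing one row of the matrix by factors between `r₁` and `r₂` changes the odds of the payoff
by a factor of at most `r₂ / r₁`. -/
theorem row_change_odds {P P' : M → M → ℝ} {D : Set M} {k : M} {a u u' : M → ℝ} {r₁ r₂ : ℝ}
    (hP : IsStochastic P) (hP' : IsStochastic P') (hD : Escapes P D) (hD' : Escapes P' D)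
    (hk : k ∉ D) (hrow : ∀ i ∉ D, i ≠ k → ∀ j, P i j = P' i j) (hr₁ : 0 < r₁)
    (h₁ : ∀ j, r₁ * P k j ≤ P' k j) (h₂ : ∀ j, P' k j ≤ r₂ * P k j)
    (ha : ∀ i, 0 ≤ a i) (ha' : ∀ i, a i ≤ 1)
    (hu : IsHarmonicExt P D a u) (hu' : IsHarmonicExt P' D a u') (i : M) :
    r₁ * (u' i * (1 - u i)) ≤ r₂ * ((1 - u' i) * u i) := by
  obtain ⟨A, hA⟩ := hP.exists_killedExt hD hk a
  obtain ⟨B, hB⟩ := hP.exists_killedExt hD hk fun i => 1 - a i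
  have hA0 := hA.nonneg hP hD fun i _ => ha i
  have hB0 := hB.nonneg hP hD fun i _ => sub_nonneg.2 (ha' i)
  have hs := hP.killed_sum_pos hD ha ha' hA hB
  have hs' := hP'.killed_sum_pos hD' ha ha' (hA.congr_matrix hrow) (hB.congr_matrix hrow)
  obtain ⟨e1, e2, e3, e4⟩ := row_change_scaled hP hP' hD hD' hk hrow hu hu' hA hB i
  have hAB : ∀ i, 0 ≤ 1 - A i - B i := by
    have h := ((hP.isHarmonicExt_const (insert k D) 1).sub hA.ext).sub hB.ext
    refine h.nonneg hP (hD.mono (Set.subset_insert k D)) ?_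
    rintro i (rfl | hi)
    · simp [hA.killed, hB.killed]
    · rw [hA.boundary i hi, hB.boundary i hi]
      linarith
  have hu0 := hu.nonneg hP hD (fun i _ => ha i) i
  have hu1 := hu.mono (hP.isHarmonicExt_const D 1) hP hD (fun i _ => ha' i) i
  have hu0' := hu'.nonneg hP' hD' (fun i _ => ha i) i
  have hu1' := hu'.mono (hP'.isHarmonicExt_const D 1) hP' hD' (fun i _ => ha' i) i
  set s := ∑ j, P k j * A j + ∑ j, P k j * B j
  set s' := ∑ j, P' k j * A j + ∑ j, P' k j * B j
  -- After scaling, payoff and complementary payoff are both linear in row `k` with nonnegative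
  -- coefficients, so the bounds on the entries apply term by term; `s` and `s'` cancel in the
  -- product of the two estimates.
  have f1 : s' * u' i ≤ r₂ * (s * u i) := by
    rw [e1, e3, Finset.mul_sum]
    refine Finset.sum_le_sum fun j _ => ?_
    rw [← mul_assoc]
    exact mul_le_mul_of_nonneg_right (h₂ j)
      (add_nonneg (mul_nonneg (hA0 i) (add_nonneg (hA0 j) (hB0 j))) (mul_nonneg (hAB i) (hA0 j)))
  have f2 : r₁ * (s * (1 - u i)) ≤ s' * (1 - u' i) := by
    rw [e2, e4, Finset.mul_sum]
    refine Finset.sum_le_sum fun j _ => ?_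
    rw [← mul_assoc]
    exact mul_le_mul_of_nonneg_right (h₁ j)
      (add_nonneg (mul_nonneg (hB0 i) (add_nonneg (hA0 j) (hB0 j))) (mul_nonneg (hAB i) (hB0 j)))
  have f3 := mul_le_mul f1 f2
    (mul_nonneg hr₁.le (mul_nonneg hs.le (sub_nonneg.2 hu1)))
    ((mul_nonneg hs'.le hu0').trans f1)
  refine le_of_mul_le_mul_left ?_ (mul_pos hs hs')
  linarith

/-- The case of equality in `row_change_odds`: from `i` the chain visits `k` before it is stopped,
and some successors of `k` lead only to one of the two actions before the next visit to `k`. -/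
theorem row_change_odds_eq {P P' : M → M → ℝ} {D : Set M} {k : M} {a u u' A B : M → ℝ} {r₁ r₂ : ℝ}
    (hP : IsStochastic P) (hP' : IsStochastic P') (hD : Escapes P D) (hD' : Escapes P' D)
    (hk : k ∉ D) (hrow : ∀ i ∉ D, i ≠ k → ∀ j, P i j = P' i j) (hr₁ : 0 < r₁) (hr : r₁ < r₂)
    (h₁ : ∀ j, r₁ * P k j ≤ P' k j) (h₂ : ∀ j, P' k j ≤ r₂ * P k j)
    (ha : ∀ i, 0 ≤ a i) (ha' : ∀ i, a i ≤ 1)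
    (hu : IsHarmonicExt P D a u) (hu' : IsHarmonicExt P' D a u')
    (hA : IsKilledExt P D k a A) (hB : IsKilledExt P D k (fun i => 1 - a i) B) {i : M}
    (hi0 : 0 < u i) (hi1 : u i < 1)
    (heq : r₁ * (u' i * (1 - u i)) = r₂ * ((1 - u' i) * u i)) :
    A i + B i = 0 ∧ (∃ j, 0 < P k j ∧ 0 < A j ∧ B j = 0) ∧
      ∃ j, 0 < P k j ∧ A j = 0 ∧ 0 < B j := by
  have hA0 := hA.nonneg hP hD fun i _ => ha i
  have hB0 := hB.nonneg hP hD fun i _ => sub_nonneg.2 (ha' i)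
  have hs := hP.killed_sum_pos hD ha ha' hA hB
  have hs' := hP'.killed_sum_pos hD' ha ha' (hA.congr_matrix hrow) (hB.congr_matrix hrow)
  obtain ⟨e1, e2, e3, e4⟩ := row_change_scaled hP hP' hD hD' hk hrow hu hu' hA hB i
  have hAB : ∀ i, 0 ≤ 1 - A i - B i := by
    have h := ((hP.isHarmonicExt_const (insert k D) 1).sub hA.ext).sub hB.ext
    refine h.nonneg hP (hD.mono (Set.subset_insert k D)) ?_
    rintro i (rfl | hi)
    · simp [hA.killed, hB.killed]
    · rw [hA.boundary i hi, hB.boundary i hi]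
      linarith
  set s := ∑ j, P k j * A j + ∑ j, P k j * B j
  set s' := ∑ j, P' k j * A j + ∑ j, P' k j * B j
  set N : M → ℝ := fun j => A i * (A j + B j) + (1 - A i - B i) * A j with hN
  set R : M → ℝ := fun j => B i * (A j + B j) + (1 - A i - B i) * B j with hR
  have hN0 : ∀ j, 0 ≤ N j := fun j =>
    add_nonneg (mul_nonneg (hA0 i) (add_nonneg (hA0 j) (hB0 j))) (mul_nonneg (hAB i) (hA0 j))
  have hR0 : ∀ j, 0 ≤ R j := fun j =>
    add_nonneg (mul_nonneg (hB0 i) (add_nonneg (hA0 j) (hB0 j))) (mul_nonneg (hAB i) (hB0 j))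
  have g1 : ∀ j, 0 ≤ (r₂ * P k j - P' k j) * N j := fun j =>
    mul_nonneg (sub_nonneg.2 (h₂ j)) (hN0 j)
  have g2 : ∀ j, 0 ≤ (P' k j - r₁ * P k j) * R j := fun j =>
    mul_nonneg (sub_nonneg.2 (h₁ j)) (hR0 j)
  have f1 : ∑ j, (r₂ * P k j - P' k j) * N j = r₂ * (s * u i) - s' * u' i := by
    rw [e1, e3, Finset.mul_sum, ← Finset.sum_sub_distrib]
    exact Finset.sum_congr rfl fun j _ => by rw [hN]; ring
  have f2 : ∑ j, (P' k j - r₁ * P k j) * R j = s' * (1 - u' i) - r₁ * (s * (1 - u i)) := by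
    rw [e2, e4, Finset.mul_sum, ← Finset.sum_sub_distrib]
    exact Finset.sum_congr rfl fun j _ => by rw [hR]; ring
  have z1 : 0 ≤ r₂ * (s * u i) - s' * u' i := f1 ▸ Finset.sum_nonneg fun j _ => g1 j
  have z2 : 0 ≤ s' * (1 - u' i) - r₁ * (s * (1 - u i)) := f2 ▸ Finset.sum_nonneg fun j _ => g2 j
  have hsu : 0 < s * u i := mul_pos hs hi0
  have hsu' : 0 < s * (1 - u i) := mul_pos hs (sub_pos.2 hi1)
  -- the two nonnegative defects have a vanishing positive combination
  have hz : (r₂ * (s * u i) - s' * u' i) * (r₁ * (s * (1 - u i)))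
      + (s' * (1 - u' i) - r₁ * (s * (1 - u i))) * (r₂ * (s * u i)) = 0 := by
    linear_combination - (s * s') * heq
  have w1 := mul_nonneg z1 (mul_pos hr₁ hsu').le
  have w2 := mul_nonneg z2 (mul_pos (hr₁.trans hr) hsu).le
  have z1' : r₂ * (s * u i) - s' * u' i = 0 :=
    (mul_eq_zero.1 (by linarith :
      (r₂ * (s * u i) - s' * u' i) * (r₁ * (s * (1 - u i))) = 0)).resolve_right
      (mul_pos hr₁ hsu').ne'
  have z2' : s' * (1 - u' i) - r₁ * (s * (1 - u i)) = 0 :=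
    (mul_eq_zero.1 (by linarith :
      (s' * (1 - u' i) - r₁ * (s * (1 - u i))) * (r₂ * (s * u i)) = 0)).resolve_right
      (mul_pos (hr₁.trans hr) hsu).ne'
  rw [z1', Finset.sum_eq_zero_iff_of_nonneg fun j _ => g1 j] at f1
  rw [z2', Finset.sum_eq_zero_iff_of_nonneg fun j _ => g2 j] at f2
  -- With both coefficients positive, the entry of the new row would have to equal both `r₂` times
  -- and `r₁` times the old one.
  have hNR : ∀ j, 0 < P k j → 0 < N j → 0 < R j → False := by
    intro j hj hNj hRj
    have k1 := (mul_eq_zero.1 (f1 j (Finset.mem_univ j))).resolve_right hNj.ne'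
    have k2 := (mul_eq_zero.1 (f2 j (Finset.mem_univ j))).resolve_right hRj.ne'
    have := mul_pos (sub_pos.2 hr) hj
    linarith
  have hex : ∀ C : M → ℝ, (∀ j, 0 ≤ C j) → 0 < ∑ j, P k j * C j → ∃ j, 0 < P k j ∧ 0 < C j := by
    intro C hC hpos
    obtain ⟨j, -, hj⟩ := Finset.exists_lt_of_sum_lt
      (s := Finset.univ) (f := fun _ : M => (0 : ℝ)) (by simpa using hpos)
    exact ⟨j, pos_of_mul_pos_left hj (hC j), pos_of_mul_pos_right hj (hP.nonneg k j)⟩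
  obtain ⟨j₁, hj₁, hN₁⟩ := hex N hN0 (by rw [← e1]; exact hsu)
  obtain ⟨j₂, hj₂, hR₂⟩ := hex R hR0 (by rw [← e2]; exact hsu')
  -- If `A i` were positive, then `j₂`, which leads to stopping before `k`, would have both
  -- coefficients positive.
  have hAi : A i = 0 := by
    by_contra h
    have hpos : 0 < A i := lt_of_le_of_ne (hA0 i) (Ne.symm h)
    refine hNR j₂ hj₂ ?_ hR₂
    have hsum : 0 < A j₂ + B j₂ := by
      by_contra! h'
      have hB2 : B j₂ = 0 := by linarith [hA0 j₂, hB0 j₂]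
      have hA2 : A j₂ = 0 := by linarith [hA0 j₂, hB0 j₂]
      simp [hR, hA2, hB2] at hR₂
    exact add_pos_of_pos_of_nonneg (mul_pos hpos hsum) (mul_nonneg (hAB i) (hA0 j₂))
  have hBi : B i = 0 := by
    by_contra h
    have hpos : 0 < B i := lt_of_le_of_ne (hB0 i) (Ne.symm h)
    refine hNR j₁ hj₁ hN₁ ?_
    have hsum : 0 < A j₁ + B j₁ := by
      by_contra! h'
      have hB2 : B j₁ = 0 := by linarith [hA0 j₁, hB0 j₁]
      have hA2 : A j₁ = 0 := by linarith [hA0 j₁, hB0 j₁]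
      simp [hN, hA2, hB2] at hN₁
    exact add_pos_of_pos_of_nonneg (mul_pos hpos hsum) (mul_nonneg (hAB i) (hB0 j₁))
  have hNA : ∀ j, N j = A j := fun j => by simp [hN, hAi, hBi]
  have hRB : ∀ j, R j = B j := fun j => by simp [hR, hAi, hBi]
  simp only [hNA, hRB] at hNR hN₁ hR₂
  refine ⟨by rw [hAi, hBi, add_zero], ⟨j₁, hj₁, hN₁, ?_⟩, j₂, hj₂, ?_, hR₂⟩
  · by_contra h
    exact hNR j₁ hj₁ hN₁ (lt_of_le_of_ne (hB0 j₁) (Ne.symm h))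
  · by_contra h
    exact hNR j₂ hj₂ (lt_of_le_of_ne (hA0 j₂) (Ne.symm h)) hR₂

/-- The odds bounds compose. -/
theorem odds_trans {x y z c d : ℝ} (hx0 : 0 ≤ x) (hx1 : x ≤ 1) (hy0 : 0 ≤ y) (hy1 : y ≤ 1)
    (hz0 : 0 ≤ z) (hz1 : z ≤ 1) (hc : 0 ≤ c) (hd : 0 ≤ d)
    (hzy : z * (1 - y) ≤ c * ((1 - z) * y)) (hyx : y * (1 - x) ≤ d * ((1 - y) * x)) :
    z * (1 - x) ≤ c * d * ((1 - z) * x) := by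
  have hcd : 0 ≤ c * d * ((1 - z) * x) :=
    mul_nonneg (mul_nonneg hc hd) (mul_nonneg (sub_nonneg.2 hz1) hx0)
  rcases hy0.eq_or_lt with rfl | hy0
  · have : z = 0 := by linarith
    simpa [this] using hcd.trans' (by simp)
  rcases hy1.eq_or_lt with rfl | hy1
  · have : x = 1 := by linarith
    subst this
    simpa using hcd
  · have h := mul_le_mul hzy hyx (mul_nonneg hy0.le (sub_nonneg.2 hx1))
      (mul_nonneg hc (mul_nonneg (sub_nonneg.2 hz1) hy0.le))
    refine le_of_mul_le_mul_left ?_ (mul_pos hy0 (sub_pos.2 hy1))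
    linarith

end Dirichlet

/-! ### Changing many rows: the odds bound and its strictness -/

section Rows

variable {M : Type*} [Fintype M]

/-- Changing the rows in `T` by factors between `r₁` and `r₂` changes the odds of the payoff by a
factor of at most `(r₂ / r₁) ^ #T`. -/
theorem rows_change_odds {P : M → M → ℝ} {D : Set M} {a u : M → ℝ} {r₁ r₂ : ℝ}
    (hP : IsStochastic P) (hD : Escapes P D) (hr₁ : 0 < r₁) (hr₂ : 0 < r₂)
    (ha : ∀ i, 0 ≤ a i) (ha' : ∀ i, a i ≤ 1) (hu : IsHarmonicExt P D a u) (T : Finset M)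
    (hT : ∀ i ∈ T, i ∉ D) {P' : M → M → ℝ} {u' : M → ℝ} (hP' : IsStochastic P')
    (hrow : ∀ i ∉ D, i ∉ T → ∀ j, P i j = P' i j)
    (h₁ : ∀ i ∈ T, ∀ j, r₁ * P i j ≤ P' i j) (h₂ : ∀ i ∈ T, ∀ j, P' i j ≤ r₂ * P i j)
    (hu' : IsHarmonicExt P' D a u') (i : M) :
    u' i * (1 - u i) ≤ (r₂ / r₁) ^ T.card * ((1 - u' i) * u i) := by
  classical
  induction T using Finset.induction_on generalizing P' u' with
  | empty =>
    have h := hu.unique (hu'.congr_matrix fun i hi j =>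
      (hrow i hi (Finset.notMem_empty i) j).symm) hP hD (fun _ _ => rfl) i
    rw [h, Finset.card_empty, pow_zero]
    linarith
  | insert k T hkT ih =>
    -- The hybrid matrix differs from `P` only in rows of `T`, and from `P'` only in row `k`.
    let Q : M → M → ℝ := fun i => if i = k then P i else P' i
    have hQk : Q k = P k := if_pos rfl
    have hQ' : ∀ i, i ≠ k → Q i = P' i := fun i hi => if_neg hi
    have hkD : k ∉ D := hT k (Finset.mem_insert_self k T)
    have hQ : IsStochastic Q := by
      constructor
      · intro i j
        by_cases hi : i = k
        · rw [hi, hQk]; exact hP.nonneg k j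
        · rw [hQ' i hi]; exact hP'.nonneg i j
      · intro i
        by_cases hi : i = k
        · rw [hi, hQk]; exact hP.sum_eq_one k
        · rw [hQ' i hi]; exact hP'.sum_eq_one i
    have hne : ∀ i ∈ T, i ≠ k := fun i hi h => hkT (h ▸ hi)
    have hQrow : ∀ i ∉ D, i ∉ T → ∀ j, P i j = Q i j := by
      intro i hiD hiT j
      by_cases hi : i = k
      · rw [hi, hQk]
      · rw [hQ' i hi]
        exact hrow i hiD (by simp [hi, hiT]) j
    have hDQ : Escapes Q D := hD.of_support fun i hiD j hij => by
      by_cases hiT : i ∈ T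
      · rw [hQ' i (hne i hiT)]
        exact (mul_pos hr₁ hij).trans_le (h₁ i (Finset.mem_insert_of_mem hiT) j)
      · rwa [← hQrow i hiD hiT]
    have hDP' : Escapes P' D := hDQ.of_support fun i _ j hij => by
      by_cases hi : i = k
      · rw [hi, hQk] at hij
        rw [hi]
        exact (mul_pos hr₁ hij).trans_le (h₁ k (Finset.mem_insert_self k T) j)
      · rwa [← hQ' i hi]
    obtain ⟨v, hv⟩ := hQ.exists_harmonicExt hDQ a
    have s1 := ih (fun i hi => hT i (Finset.mem_insert_of_mem hi)) hQ hQrow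
      (fun i hi j => by rw [hQ' i (hne i hi)]; exact h₁ i (Finset.mem_insert_of_mem hi) j)
      (fun i hi j => by rw [hQ' i (hne i hi)]; exact h₂ i (Finset.mem_insert_of_mem hi) j) hv
    have s2 := row_change_odds hQ hP' hDQ hDP' hkD (fun i _ hi j => by rw [hQ' i hi]) hr₁
      (fun j => by rw [hQk]; exact h₁ k (Finset.mem_insert_self k T) j)
      (fun j => by rw [hQk]; exact h₂ k (Finset.mem_insert_self k T) j) ha ha' hv hu' i
    have s2' : u' i * (1 - v i) ≤ r₂ / r₁ * ((1 - u' i) * v i) := by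
      rw [div_mul_eq_mul_div, le_div_iff₀ hr₁]
      linarith
    rw [Finset.card_insert_of_notMem hkT, pow_succ']
    exact odds_trans (hu.nonneg hP hD (fun i _ => ha i) i)
      (hu.mono (hP.isHarmonicExt_const D 1) hP hD (fun i _ => ha' i) i)
      (hv.nonneg hQ hDQ (fun i _ => ha i) i)
      (hv.mono (hQ.isHarmonicExt_const D 1) hQ hDQ (fun i _ => ha' i) i)
      (hu'.nonneg hP' hDP' (fun i _ => ha i) i)
      (hu'.mono (hP'.isHarmonicExt_const D 1) hP' hDP' (fun i _ => ha' i) i)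
      (div_pos hr₂ hr₁).le (pow_pos (div_pos hr₂ hr₁) _).le s2' s1

/-- If from `i` every state outside `D` is visited before the chain is stopped, then exactly one
state leads to `D`; hence the successors of any other state cannot separate the two actions. -/
theorem not_separating {P : M → M → ℝ} {D : Set M} {a : M → ℝ} (hP : IsStochastic P)
    (hD : Escapes P D) (ha : ∀ i, 0 ≤ a i) (ha' : ∀ i, a i ≤ 1) (A B : M → M → ℝ)
    (hA : ∀ k ∉ D, IsKilledExt P D k a (A k))
    (hB : ∀ k ∉ D, IsKilledExt P D k (fun i => 1 - a i) (B k)) {i k₁ k₂ : M} (hk₁ : k₁ ∉ D)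
    (hk₂ : k₂ ∉ D) (hne : k₁ ≠ k₂) (hi : ∀ k ∉ D, A k i + B k i = 0)
    (hA' : ∀ k ∉ D, ∃ j, 0 < P k j ∧ 0 < A k j ∧ B k j = 0)
    (hB' : ∀ k ∉ D, ∃ j, 0 < P k j ∧ A k j = 0 ∧ 0 < B k j) : False := by
  classical
  have hA0 : ∀ k ∉ D, ∀ j, 0 ≤ A k j := fun k hk => (hA k hk).nonneg hP hD fun i _ => ha i
  have hB0 : ∀ k ∉ D, ∀ j, 0 ≤ B k j := fun k hk =>
    (hB k hk).nonneg hP hD fun i _ => sub_nonneg.2 (ha' i)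
  have hsD : ∀ k ∉ D, ∀ j ∈ D, A k j + B k j = 1 := fun k hk j hj => by
    rw [(hA k hk).boundary j hj, (hB k hk).boundary j hj]; ring
  have hharm : ∀ k ∉ D, ∀ l ∉ D, l ≠ k → ∑ j, P l j * (A k j + B k j) = A k l + B k l := by
    intro k hk l hl hlk
    have hl' : l ∉ insert k D := by rintro (h | h); exacts [hlk h, hl h]
    simp only [mul_add, Finset.sum_add_distrib, (hA k hk).ext.harmonic l hl',
      (hB k hk).ext.harmonic l hl']
  have hpos : ∀ k ∉ D, ∀ l ∉ D, l ≠ k → ∀ j, 0 < P l j → 0 < A k j + B k j →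
      0 < A k l + B k l := by
    intro k hk l hl hlk j hlj hj
    rw [← hharm k hk l hl hlk]
    exact Finset.sum_pos'
      (fun m _ => mul_nonneg (hP.nonneg l m) (add_nonneg (hA0 k hk m) (hB0 k hk m)))
      ⟨j, Finset.mem_univ j, mul_pos hlj hj⟩
  have hiD : i ∉ D := fun h => by have := hi k₁ hk₁; rw [hsD k₁ hk₁ i h] at this; linarith
  obtain ⟨k, hk, d, hd, hkd⟩ := hD Dᶜ ⟨i, hiD⟩ disjoint_compl_left
  have hd : d ∈ D := not_not.1 hd
  have hk : k ∉ D := hk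
  -- `k` is the only state with a transition to `D`
  have huniq : ∀ l ∉ D, l ≠ k → ∀ j ∈ D, P l j = 0 := by
    intro l hl hlk j hj
    by_contra hlj
    have hlj : 0 < P l j := lt_of_le_of_ne (hP.nonneg l j) (Ne.symm hlj)
    -- States that cannot reach `D` while avoiding `k`, nor while avoiding `l`. The set excludes `k`
    -- and `l`, since each has a direct transition to `D`; so it has no way out, although it
    -- contains `i`.
    obtain ⟨x, ⟨hx1, hx2⟩, y, hy, hxy⟩ := hD {x | A k x + B k x = 0 ∧ A l x + B l x = 0}
      ⟨i, hi k hk, hi l hl⟩ (Set.disjoint_left.2 fun x hx hxD => by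
        have := hsD k hk x hxD
        rw [hx.1] at this
        linarith)
    have hxD : x ∉ D := fun h => by rw [hsD k hk x h] at hx1; linarith
    have hxk : x ≠ k := by
      rintro rfl
      have := hpos l hl x hk hlk.symm d hkd (by rw [hsD l hl d hd]; exact one_pos)
      linarith
    have hxl : x ≠ l := by
      rintro rfl
      have := hpos k hk x hl hlk j hlj (by rw [hsD k hk j hj]; exact one_pos)
      linarith
    refine hy ⟨?_, ?_⟩
    · by_contra h
      have := hpos k hk x hxD hxk y hxy
        (lt_of_le_of_ne (add_nonneg (hA0 k hk y) (hB0 k hk y)) (Ne.symm h))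
      linarith
    · by_contra h
      have := hpos l hl x hxD hxl y hxy
        (lt_of_le_of_ne (add_nonneg (hA0 l hl y) (hB0 l hl y)) (Ne.symm h))
      linarith
  obtain ⟨l, hl, hlk⟩ : ∃ l, l ∉ D ∧ l ≠ k := by
    by_cases h : k₁ = k
    · exact ⟨k₂, hk₂, fun h' => hne (h.trans h'.symm)⟩
    · exact ⟨k₁, hk₁, h⟩
  -- The determinant of `(A l, B l)` at `j` and at `k`. Cutting it to zero on `D` keeps it harmonic
  -- away from `k` and `l`, as only `k` has transitions into `D`. It vanishes, so outside `D` all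
  -- pairs `(A l, B l)` are proportional to the pair at `k`.
  have hφ : IsHarmonicExt P (insert k (insert l D)) (fun _ => 0)
      (fun j => if j ∈ D then 0 else B l k * A l j - A l k * B l j) := by
    constructor
    · rintro j (rfl | rfl | hj)
      · rw [if_neg hk]; ring
      · rw [if_neg hl, (hA j hl).killed, (hB j hl).killed]; ring
      · rw [if_pos hj]
    · intro x hx
      have hxk : x ≠ k := fun h => hx (Or.inl h)
      have hxl : x ≠ l := fun h => hx (Or.inr (Or.inl h))
      have hxD : x ∉ D := fun h => hx (Or.inr (Or.inr h))
      have hx' : x ∉ insert l D := fun h => hx (Or.inr h)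
      rw [if_neg hxD, ← (hA l hl).ext.harmonic x hx', ← (hB l hl).ext.harmonic x hx',
        Finset.mul_sum, Finset.mul_sum, ← Finset.sum_sub_distrib]
      refine Finset.sum_congr rfl fun j _ => ?_
      by_cases hj : j ∈ D
      · rw [huniq x hxD hxk j hj]; ring
      · rw [if_neg hj]; ring
  have hφ0 : ∀ j ∉ D, B l k * A l j - A l k * B l j = 0 := by
    intro j hj
    have := hφ.unique (hP.isHarmonicExt_const _ 0) hP
      (hD.mono ((Set.subset_insert l D).trans (Set.subset_insert k _))) (fun _ _ => rfl) j
    simpa [hj] using this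
  have hsucc : ∀ j, 0 < P l j → j ∉ D := fun j hj hjD => hj.ne' (huniq l hl hlk j hjD)
  -- Successors of `l` of the two pure kinds force both entries of the pair at `k` to be zero, yet
  -- `k` reaches `D` in one step.
  obtain ⟨j₁, hj₁, hA₁, hB₁⟩ := hA' l hl
  obtain ⟨j₂, hj₂, hA₂, hB₂⟩ := hB' l hl
  have e1 := hφ0 j₁ (hsucc j₁ hj₁)
  have e2 := hφ0 j₂ (hsucc j₂ hj₂)
  rw [hB₁, mul_zero, sub_zero] at e1
  rw [hA₂, mul_zero, zero_sub, neg_eq_zero] at e2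
  have f1 := (mul_eq_zero.1 e1).resolve_right hA₁.ne'
  have f2 := (mul_eq_zero.1 e2).resolve_right hB₂.ne'
  have := hpos l hl k hk hlk.symm d hkd (by rw [hsD l hl d hd]; exact one_pos)
  linarith

/-- With at least two states outside `D`, the bound on the odds is strict. -/
theorem rows_change_odds_lt {P : M → M → ℝ} {D : Set M} {a u : M → ℝ} {r₁ r₂ : ℝ}
    (hP : IsStochastic P) (hD : Escapes P D) (hr₁ : 0 < r₁) (hr : r₁ < r₂)
    (ha : ∀ i, 0 ≤ a i) (ha' : ∀ i, a i ≤ 1) (hu : IsHarmonicExt P D a u) (T : Finset M)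
    (hT : ∀ i, i ∈ T ↔ i ∉ D) (hcard : 2 ≤ T.card) {P' : M → M → ℝ} {u' : M → ℝ}
    (hP' : IsStochastic P')
    (h₁ : ∀ i ∈ T, ∀ j, r₁ * P i j ≤ P' i j) (h₂ : ∀ i ∈ T, ∀ j, P' i j ≤ r₂ * P i j)
    (hu' : IsHarmonicExt P' D a u') {i : M} (hi0 : 0 < u i) (hi1 : u i < 1) (hi0' : 0 < u' i) :
    u' i * (1 - u i) < (r₂ / r₁) ^ T.card * ((1 - u' i) * u i) := by
  classical
  have hr₂ : 0 < r₂ := hr₁.trans hr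
  refine lt_of_le_of_ne (rows_change_odds hP hD hr₁ hr₂ ha ha' hu T (fun i hi => (hT i).1 hi) hP'
    (fun i hiD hiT => absurd ((hT i).2 hiD) hiT) h₁ h₂ hu' i) fun heq => ?_
  choose! A hA using fun k (hk : k ∉ D) => hP.exists_killedExt hD hk a
  choose! B hB using fun k (hk : k ∉ D) => hP.exists_killedExt hD hk fun i => 1 - a i
  have key : ∀ k ∉ D, A k i + B k i = 0 ∧ (∃ j, 0 < P k j ∧ 0 < A k j ∧ B k j = 0) ∧
      ∃ j, 0 < P k j ∧ A k j = 0 ∧ 0 < B k j := by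
    intro k hk
    have hkT : k ∈ T := (hT k).2 hk
    -- Here row `k` is changed first, starting from `P`. The equality case then speaks of the same
    -- chain `P` for every `k`, as `not_separating` needs.
    let Q : M → M → ℝ := fun i => if i = k then P' i else P i
    have hQk : Q k = P' k := if_pos rfl
    have hQ' : ∀ i, i ≠ k → Q i = P i := fun i hi => if_neg hi
    have hQ : IsStochastic Q := by
      constructor
      · intro i j
        by_cases hi : i = k
        · rw [hi, hQk]; exact hP'.nonneg k j
        · rw [hQ' i hi]; exact hP.nonneg i j
      · intro i
        by_cases hi : i = k
        · rw [hi, hQk]; exact hP'.sum_eq_one k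
        · rw [hQ' i hi]; exact hP.sum_eq_one i
    have hDQ : Escapes Q D := hD.of_support fun i hiD j hij => by
      by_cases hi : i = k
      · rw [hi, hQk]
        rw [hi] at hij
        exact (mul_pos hr₁ hij).trans_le (h₁ k hkT j)
      · rwa [hQ' i hi]
    obtain ⟨v, hv⟩ := hQ.exists_harmonicExt hDQ a
    have hne : ∀ i ∈ T.erase k, i ≠ k := fun i hi => Finset.ne_of_mem_erase hi
    have s1 := rows_change_odds hQ hDQ hr₁ hr₂ ha ha' hv (T.erase k)
      (fun i hi => (hT i).1 (Finset.mem_of_mem_erase hi)) hP'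
      (fun i hiD hiT j => by
        have : i = k := by
          by_contra h
          exact hiT (Finset.mem_erase.2 ⟨h, (hT i).2 hiD⟩)
        rw [this, hQk])
      (fun i hi j => by rw [hQ' i (hne i hi)]; exact h₁ i (Finset.mem_of_mem_erase hi) j)
      (fun i hi j => by rw [hQ' i (hne i hi)]; exact h₂ i (Finset.mem_of_mem_erase hi) j) hu' i
    have s2 := row_change_odds hP hQ hD hDQ hk (fun i _ hi j => by rw [hQ' i hi]) hr₁
      (fun j => by rw [hQk]; exact h₁ k hkT j)
      (fun j => by rw [hQk]; exact h₂ k hkT j) ha ha' hu hv i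
    refine row_change_odds_eq hP hQ hD hDQ hk (fun i _ hi j => by rw [hQ' i hi]) hr₁ hr
      (fun j => by rw [hQk]; exact h₁ k hkT j)
      (fun j => by rw [hQk]; exact h₂ k hkT j) ha ha' hu hv (hA k hk) (hB k hk) hi0 hi1
      (s2.antisymm ?_)
    -- a strict first step would make the whole chain of inequalities strict
    have hv0 : 0 ≤ v i := hv.nonneg hQ hDQ (fun i _ => ha i) i
    have hv1 : v i ≤ 1 := hv.mono (hQ.isHarmonicExt_const D 1) hQ hDQ (fun i _ => ha' i) i
    have hc : 0 < (r₂ / r₁) ^ (T.erase k).card := pow_pos (div_pos hr₂ hr₁) _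
    have hpow : r₁ * (r₂ / r₁) ^ T.card = (r₂ / r₁) ^ (T.erase k).card * r₂ := by
      rw [← Finset.card_erase_add_one hkT, pow_succ]
      field_simp
    have hv1' : 0 < 1 - v i := by
      refine sub_pos.2 (lt_of_le_of_ne hv1 fun h => ?_)
      rw [h] at s2
      have := mul_pos hr₁ (sub_pos.2 hi1)
      linarith
    have hx : 0 < u' i * (1 - v i) := mul_pos hi0' hv1'
    refine le_of_mul_le_mul_left ?_ hx
    have h3 := mul_le_mul_of_nonneg_right s1 (mul_pos hr₂ hi0).le
    have h4 := congrArg (fun t => r₁ * t) heq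
    simp only [← mul_assoc] at h4
    rw [hpow] at h4
    have h5 : u' i * (1 - v i) * (r₂ * ((1 - v i) * u i))
        ≤ (1 - v i) * ((r₂ / r₁) ^ (T.erase k).card * r₂ * (1 - u' i) * u i * v i) := by
      have := mul_le_mul_of_nonneg_left h3 hv1'.le
      linarith
    rw [← h4] at h5
    linarith
  obtain ⟨k₁, hk₁, k₂, hk₂, hne⟩ := Finset.one_lt_card.1 hcard
  exact not_separating hP hD ha ha' A B hA hB ((hT k₁).1 hk₁) ((hT k₂).1 hk₂) hne
    (fun k hk => (key k hk).1) (fun k hk => (key k hk).2.1) fun k hk => (key k hk).2.2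

end Rows

/-! ### Value functions of optimal stopping -/

section Value

variable {M : Type*} [Fintype M]

/-- `v` is the value function of the problem of stopping the chain `P` with reward `a`. -/
structure IsValue (P : M → M → ℝ) (a v : M → ℝ) : Prop where
  le : ∀ i, a i ≤ v i
  superharmonic : ∀ i, ∑ j, P i j * v j ≤ v i
  harmonic : ∀ i, v i ≠ a i → ∑ j, P i j * v j = v i
  escapes : Escapes P {i | v i = a i}

-- The pointwise infimum of the superharmonic majorants works, by minimality: a defect of
-- harmonicity at a continuation state, or a closed set of continuation states, would leave room for
-- a smaller majorant.
open Classical in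
theorem IsStochastic.exists_isValue {P : M → M → ℝ} (hP : IsStochastic P) {a : M → ℝ}
    (ha : ∀ i, a i ≤ 1) : ∃ v, IsValue P a v := by
  let W : Set (M → ℝ) := {w | (∀ i, a i ≤ w i) ∧ ∀ i, ∑ j, P i j * w j ≤ w i}
  have h1 : (fun _ => 1) ∈ W := ⟨ha, fun i => by simp [hP.sum_eq_one]⟩
  let v : M → ℝ := fun i => sInf ((fun w : M → ℝ => w i) '' W)
  have hbdd : ∀ i, BddBelow ((fun w : M → ℝ => w i) '' W) := fun i =>
    ⟨a i, by rintro _ ⟨w, hw, rfl⟩; exact hw.1 i⟩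
  have hne : ∀ i, ((fun w : M → ℝ => w i) '' W).Nonempty := fun i => ⟨_, _, h1, rfl⟩
  have hmin : ∀ w ∈ W, ∀ i, v i ≤ w i := fun w hw i => csInf_le (hbdd i) ⟨w, hw, rfl⟩
  have hle : ∀ i, a i ≤ v i := fun i => le_csInf (hne i) (by rintro _ ⟨w, hw, rfl⟩; exact hw.1 i)
  have hsup : ∀ i, ∑ j, P i j * v j ≤ v i := fun i => le_csInf (hne i) (by
    rintro _ ⟨w, hw, rfl⟩
    exact (Finset.sum_le_sum fun j _ =>
      mul_le_mul_of_nonneg_left (hmin w hw j) (hP.nonneg i j)).trans (hw.2 i))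
  have hmono : ∀ w : M → ℝ, (∀ j, w j ≤ v j) → ∀ i, ∑ j, P i j * w j ≤ ∑ j, P i j * v j :=
    fun w hw i => Finset.sum_le_sum fun j _ => mul_le_mul_of_nonneg_left (hw j) (hP.nonneg i j)
  refine ⟨v, hle, hsup, fun i hi => ?_, fun T hT hTD => ?_⟩
  · by_contra h
    have hlt : ∑ j, P i j * v j < v i := lt_of_le_of_ne (hsup i) h
    have hai : a i < v i := lt_of_le_of_ne (hle i) hi.symm
    set w : M → ℝ := Function.update v i (max (a i) (∑ j, P i j * v j)) with hw
    have hwi : w i = max (a i) (∑ j, P i j * v j) := by rw [hw, Function.update_self]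
    have hwj : ∀ j, j ≠ i → w j = v j := fun j hj => by rw [hw, Function.update_of_ne hj]
    have hwv : ∀ j, w j ≤ v j := by
      intro j
      by_cases hj : j = i
      · rw [hj, hwi]; exact max_le hai.le hlt.le
      · rw [hwj j hj]
    have hwW : w ∈ W := by
      constructor
      · intro j
        by_cases hj : j = i
        · rw [hj, hwi]; exact le_max_left _ _
        · rw [hwj j hj]; exact hle j
      · intro j
        refine (hmono w hwv j).trans ?_
        by_cases hj : j = i
        · rw [hj, hwi]; exact le_max_right _ _
        · rw [hwj j hj]; exact hsup j
    have := hmin w hwW i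
    rw [hwi] at this
    exact absurd this (not_le.2 (max_lt hai hlt))
  · by_contra! hcl
    have hcl' : ∀ i ∈ T, ∀ j ∉ T, P i j = 0 := fun i hi j hj =>
      le_antisymm (hcl i hi j hj) (hP.nonneg i j)
    -- The least gap on the closed set `T`. Subtracting it throughout `T` preserves
    -- superharmonicity, because rows of `T` put no mass outside `T`.
    obtain ⟨k, hk, hkmin⟩ := T.toFinite.toFinset.exists_min_image (fun i => v i - a i)
      (by simpa using hT)
    rw [Set.Finite.mem_toFinset] at hk
    set ε := v k - a k with hε
    have hε0 : 0 < ε := sub_pos.2 (lt_of_le_of_ne (hle k) fun h =>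
      Set.disjoint_left.1 hTD hk h.symm)
    let w : M → ℝ := fun i => if i ∈ T then v i - ε else v i
    have hwv : ∀ j, w j ≤ v j := fun j => by
      by_cases hj : j ∈ T
      · simp only [w, if_pos hj]; linarith
      · simp only [w, if_neg hj]; exact le_rfl
    have hwW : w ∈ W := by
      constructor
      · intro j
        by_cases hj : j ∈ T
        · have := hkmin j (by simpa using hj)
          simp only [w, if_pos hj]
          linarith
        · simp only [w, if_neg hj]; exact hle j
      · intro i
        by_cases hi : i ∈ T
        · have : ∑ j, P i j * w j = ∑ j, P i j * v j - ∑ j, P i j * ε := by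
            rw [← Finset.sum_sub_distrib]
            refine Finset.sum_congr rfl fun j _ => ?_
            by_cases hj : j ∈ T
            · simp only [w, if_pos hj]; ring
            · rw [hcl' i hi j hj]; ring
          rw [this, ← Finset.sum_mul, hP.sum_eq_one, one_mul]
          simp only [w, if_pos hi]
          linarith [hsup i]
        · have := (hmono w hwv i).trans (hsup i)
          simpa only [w, if_neg hi] using this
    have := hmin w hwW k
    simp only [w, if_pos hk] at this
    linarith

theorem IsValue.isHarmonicExt {P : M → M → ℝ} {a v : M → ℝ} (hv : IsValue P a v) :
    IsHarmonicExt P {i | v i = a i} a v :=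
  ⟨fun _ hi => hi, fun i hi => hv.harmonic i hi⟩

/-- The value is at least the payoff from stopping on any set that is reached. -/
theorem IsValue.harmonicExt_le {P : M → M → ℝ} {D : Set M} {a v u : M → ℝ} (hv : IsValue P a v)
    (hP : IsStochastic P) (hD : Escapes P D) (hu : IsHarmonicExt P D a u) (i : M) : u i ≤ v i := by
  refine sub_nonneg.1 (hP.nonneg_of_superharmonic hD (u := fun i => v i - u i)
    (fun i hi => ?_) (fun i hi => ?_) i)
  · rw [hu.boundary i hi]; exact sub_nonneg.2 (hv.le i)
  · simp only [mul_sub, Finset.sum_sub_distrib, hu.harmonic i hi]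
    linarith [hv.superharmonic i]

end Value

/-! ### From stopping problems to payoffs of the game -/

section Play

variable {S M : Type*} [Fintype S] [Fintype M] {E : Experiment S} {P : Protocol S M}
  {σ : Strategy M} {θ : Nature}

theorem isStochastic_transition (E : Experiment S) (P : Protocol S M) (θ : Nature) :
    IsStochastic (transition E P θ) :=
  ⟨transition_nonneg E P θ, transition_sum E P θ⟩

theorem sum_activeProb_succ (E : Experiment S) (P : Protocol S M) (σ : Strategy M) (θ : Nature)
    (u : M → ℝ) (n : ℕ) :
    ∑ j, activeProb E P σ θ (n + 1) j * u j
      = ∑ i, activeProb E P σ θ n i * ((1 - endRate P σ θ i) * ∑ j, transition E P θ i j * u j) := by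
  simp only [activeProb, Finset.sum_mul]
  rw [Finset.sum_comm]
  refine Finset.sum_congr rfl fun i _ => ?_
  rw [Finset.mul_sum, Finset.mul_sum]
  exact Finset.sum_congr rfl fun j _ => by ring

/-- The reward collected so far plus `u` of the current state is a supermartingale. -/
theorem partial_payoff_le {b u : M → ℝ}
    (h : ∀ i, endRate P σ θ i * b i + (1 - endRate P σ θ i) * ∑ j, transition E P θ i j * u j ≤ u i)
    (n : ℕ) :
    ∑ t ∈ Finset.range n, ∑ i, activeProb E P σ θ t i * endRate P σ θ i * b i
      + ∑ i, activeProb E P σ θ n i * u i ≤ ∑ i, P.g.1 i * u i := by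
  induction n with
  | zero => simp [activeProb]
  | succ n ih =>
    refine le_trans ?_ ih
    rw [Finset.sum_range_succ, add_assoc, sum_activeProb_succ, ← Finset.sum_add_distrib]
    refine add_le_add_right (Finset.sum_le_sum fun i _ => ?_) _
    have := mul_le_mul_of_nonneg_left (h i) (activeProb_nonneg E P σ θ n i)
    linarith

theorem partial_payoff_eq {b u : M → ℝ}
    (h : ∀ i, endRate P σ θ i * b i + (1 - endRate P σ θ i) * ∑ j, transition E P θ i j * u j = u i)
    (n : ℕ) :
    ∑ t ∈ Finset.range n, ∑ i, activeProb E P σ θ t i * endRate P σ θ i * b i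
      + ∑ i, activeProb E P σ θ n i * u i = ∑ i, P.g.1 i * u i := by
  refine le_antisymm (partial_payoff_le (fun i => (h i).le) n) ?_
  have := partial_payoff_le (E := E) (P := P) (σ := σ) (θ := θ) (b := fun i => - b i)
    (u := fun i => - u i) (fun i => by
      simp only [mul_neg, Finset.sum_neg_distrib]
      linarith [h i]) n
  simp only [mul_neg, Finset.sum_neg_distrib] at this
  linarith

theorem hasSum_payoff (E : Experiment S) (P : Protocol S M) (σ : Strategy M) (θ : Nature)
    (b : M → ℝ) :
    HasSum (fun t => ∑ i, activeProb E P σ θ t i * endRate P σ θ i * b i)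
      (∑ i, endProb E P σ θ i * b i) :=
  hasSum_sum fun i _ => (summable_activeProb_mul_endRate E P σ θ i).hasSum.mul_right (b i)

/-- As `u` is nonnegative, the contribution of play still active can be dropped, so this covers
strategies under which the game may never end. -/
theorem sum_endProb_mul_le {b u : M → ℝ} (hu : ∀ i, 0 ≤ u i)
    (h : ∀ i, endRate P σ θ i * b i
      + (1 - endRate P σ θ i) * ∑ j, transition E P θ i j * u j ≤ u i) :
    ∑ i, endProb E P σ θ i * b i ≤ ∑ i, P.g.1 i * u i := by
  refine le_of_tendsto' (hasSum_payoff E P σ θ b).tendsto_sum_nat fun n => ?_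
  have h1 := partial_payoff_le h n
  have h2 : 0 ≤ ∑ i, activeProb E P σ θ n i * u i :=
    Finset.sum_nonneg fun i _ => mul_nonneg (activeProb_nonneg E P σ θ n i) (hu i)
  linarith

/-- If the game ends in every state of a set that is reached from everywhere, it ends almost
surely. -/
theorem tendsto_sum_activeProb {D : Set M} (hD : Escapes (transition E P θ) D)
    (hσ : ∀ i ∈ D, endRate P σ θ i = 1) :
    Tendsto (fun n => ∑ i, activeProb E P σ θ n i) atTop (𝓝 0) := by
  have hP := isStochastic_transition E P θ
  -- A Lyapunov function: the expected number of periods up to and including the first in `D`. Each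
  -- period lowers its mean by at least the active mass, so the active masses are summable.
  obtain ⟨τ, hτ, hτ'⟩ := hP.exists_dirichlet hD fun _ => 1
  have hτ0 : ∀ i, 0 ≤ τ i := hP.nonneg_of_superharmonic hD (fun i hi => by rw [hτ i hi]; norm_num)
    fun i hi => by rw [hτ' i hi]; linarith
  have hPτ : ∀ i, 0 ≤ ∑ j, transition E P θ i j * τ j := fun i =>
    Finset.sum_nonneg fun j _ => mul_nonneg (transition_nonneg E P θ i j) (hτ0 j)
  have hs : ∀ n, ∑ i, activeProb E P σ θ n i
      ≤ ∑ i, activeProb E P σ θ n i * τ i - ∑ i, activeProb E P σ θ (n + 1) i * τ i := by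
    intro n
    rw [sum_activeProb_succ, ← Finset.sum_sub_distrib]
    refine Finset.sum_le_sum fun i _ => ?_
    rw [← mul_sub]
    refine le_mul_of_one_le_right (activeProb_nonneg E P σ θ n i) ?_
    by_cases hi : i ∈ D
    · rw [hσ i hi, hτ i hi]; linarith
    · have := mul_nonneg (endRate_nonneg P σ θ i) (hPτ i)
      linarith [hτ' i hi]
  refine (summable_of_sum_range_le (c := ∑ i, activeProb E P σ θ 0 i * τ i)
    (fun n => Finset.sum_nonneg fun i _ => activeProb_nonneg E P σ θ n i)
    fun n => ?_).tendsto_atTop_zero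
  refine (Finset.sum_le_sum fun t _ => hs t).trans ?_
  rw [Finset.sum_range_sub']
  have : 0 ≤ ∑ i, activeProb E P σ θ n i * τ i :=
    Finset.sum_nonneg fun i _ => mul_nonneg (activeProb_nonneg E P σ θ n i) (hτ0 i)
  linarith

/-- Here the active mass vanishes in the limit, so the telescoped identity is exact. -/
theorem sum_endProb_mul_eq {D : Set M} (hD : Escapes (transition E P θ) D)
    (hσ : ∀ i ∈ D, endRate P σ θ i = 1) {b u : M → ℝ}
    (h : ∀ i, endRate P σ θ i * b i
      + (1 - endRate P σ θ i) * ∑ j, transition E P θ i j * u j = u i) :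
    ∑ i, endProb E P σ θ i * b i = ∑ i, P.g.1 i * u i := by
  have h0 := tendsto_sum_activeProb hD hσ
  have h1 : ∀ i, Tendsto (fun n => activeProb E P σ θ n i) atTop (𝓝 0) := fun i =>
    squeeze_zero (fun n => activeProb_nonneg E P σ θ n i)
      (fun n => Finset.single_le_sum (fun j _ => activeProb_nonneg E P σ θ n j)
        (Finset.mem_univ i)) h0
  have h2 : Tendsto (fun n => ∑ i, activeProb E P σ θ n i * u i) atTop (𝓝 0) := by
    simpa using tendsto_finsetSum Finset.univ fun i _ => (h1 i).mul_const (u i)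
  have h3 := (hasSum_payoff E P σ θ b).tendsto_sum_nat.add h2
  simp only [partial_payoff_eq h, add_zero] at h3
  exact tendsto_nhds_unique h3 tendsto_const_nhds |>.symm ▸ rfl

theorem sum_endProb_le_one (E : Experiment S) (P : Protocol S M) (σ : Strategy M) (θ : Nature) :
    ∑ i, endProb E P σ θ i ≤ 1 := by
  have := sum_endProb_mul_le (E := E) (P := P) (σ := σ) (θ := θ) (b := fun _ => 1)
    (u := fun _ => 1) (fun _ => zero_le_one) fun i => by simp [transition_sum]
  simpa [P.g.2.2] using this

theorem sum_endProb_eq_one {D : Set M} (hD : Escapes (transition E P θ) D)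
    (hσ : ∀ i ∈ D, endRate P σ θ i = 1) : ∑ i, endProb E P σ θ i = 1 := by
  have := sum_endProb_mul_eq hD hσ (b := fun _ => 1) (u := fun _ => 1)
    fun i => by simp [transition_sum]
  simpa [P.g.2.2] using this

theorem IsValue.sum_endProb_mul_le {v : M → ℝ}
    (hv : IsValue (transition E P θ) (fun i => (P.a i : ℝ)) v) (σ : Strategy M) :
    ∑ i, endProb E P σ θ i * (P.a i : ℝ) ≤ ∑ i, P.g.1 i * v i := by
  refine StrategicMemory.sum_endProb_mul_le (fun i => (P.a i).2.1.trans (hv.le i)) fun i => ?_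
  have h1 := mul_le_mul_of_nonneg_left (hv.le i) (endRate_nonneg P σ θ i)
  have h2 := mul_le_mul_of_nonneg_left (hv.superharmonic i)
    (sub_nonneg.2 (endRate_le_one P σ θ i))
  linarith

open Classical in
/-- Stop exactly where the value function equals the reward. -/
noncomputable def stoppingStrategy (P : Protocol S M) (v : Nature → M → ℝ) : Strategy M :=
  fun i θ => if v θ i = P.a i then 1 else 0

theorem Protocol.Absorbing.transition_eq_one {i : M} (h : P.Absorbing i) :
    transition E P θ i i = 1 := by
  unfold transition
  simp_rw [h _, mul_one, E.prob_sum]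

/-- Forced ending in absorbing states never conflicts with this strategy: an absorbing state with
value above reward would be a closed set missing the stopping set. -/
theorem IsValue.endRate_stoppingStrategy {v : Nature → M → ℝ}
    (hv : IsValue (transition E P θ) (fun i => (P.a i : ℝ)) (v θ)) (i : M) [Decidable (v θ i = P.a i)] :
    endRate P (stoppingStrategy P v) θ i = if v θ i = P.a i then 1 else 0 := by
  unfold endRate stoppingStrategy
  by_cases h : v θ i = P.a i
  · simp [h]
  · rw [if_neg, if_neg h, if_neg h]
    · rfl
    · intro hi
      obtain ⟨j, hj, l, hl, hjl⟩ := hv.escapes {i} (Set.singleton_nonempty i)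
        (Set.disjoint_singleton_left.2 h)
      rw [Set.mem_singleton_iff] at hj
      subst hj
      have h1 := transition_sum E P θ j
      have h2 : transition E P θ j j + transition E P θ j l ≤ ∑ k, transition E P θ j k :=
        Finset.add_le_sum (fun k _ => transition_nonneg E P θ j k) (Finset.mem_univ j)
          (Finset.mem_univ l) fun h => hl h.symm
      rw [hi.transition_eq_one, h1] at h2
      linarith

open Classical in
theorem IsValue.sum_endProb_mul_eq {v : Nature → M → ℝ}
    (hv : IsValue (transition E P θ) (fun i => (P.a i : ℝ)) (v θ)) :
    ∑ i, endProb E P (stoppingStrategy P v) θ i * (P.a i : ℝ) = ∑ i, P.g.1 i * v θ i := by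
  refine StrategicMemory.sum_endProb_mul_eq hv.escapes (fun i hi => ?_) fun i => ?_
  · rw [hv.endRate_stoppingStrategy, if_pos (show v θ i = P.a i from hi)]
  · rw [hv.endRate_stoppingStrategy]
    by_cases h : v θ i = P.a i
    · simp [h]
    · simp [h, hv.harmonic i h]

variable {p : ℝ} {v : Nature → M → ℝ}

theorem stoppingStrategy_mem_bestResponses (hp0 : 0 < p) (hp1 : p < 1)
    (hv : ∀ θ, IsValue (transition E P θ) (fun i => (P.a i : ℝ)) (v θ)) :
    stoppingStrategy P v ∈ bestResponses E p P := by
  intro σ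
  unfold senderPayoff
  rw [(hv _).sum_endProb_mul_eq, (hv _).sum_endProb_mul_eq]
  exact add_le_add (mul_le_mul_of_nonneg_left ((hv _).sum_endProb_mul_le σ) hp0.le)
    (mul_le_mul_of_nonneg_left ((hv _).sum_endProb_mul_le σ) (sub_pos.2 hp1).le)

theorem bestResponses_nonempty (E : Experiment S) (P : Protocol S M) (hp0 : 0 < p) (hp1 : p < 1) :
    (bestResponses E p P).Nonempty := by
  choose v hv using fun θ => (isStochastic_transition E P θ).exists_isValue fun i => (P.a i).2.2
  exact ⟨_, stoppingStrategy_mem_bestResponses hp0 hp1 hv⟩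

/-- A best response yields the value in either state of nature. -/
theorem sum_endProb_of_mem_bestResponses (hp0 : 0 < p) (hp1 : p < 1)
    (hv : ∀ θ, IsValue (transition E P θ) (fun i => (P.a i : ℝ)) (v θ))
    (hσ : σ ∈ bestResponses E p P) :
    ∑ i, endProb E P σ θ i * (P.a i : ℝ) = ∑ i, P.g.1 i * v θ i := by
  have h := hσ (stoppingStrategy P v)
  unfold senderPayoff at h
  rw [(hv _).sum_endProb_mul_eq, (hv _).sum_endProb_mul_eq] at h
  have hH := (hv Nature.H).sum_endProb_mul_le σ
  have hL := (hv Nature.L).sum_endProb_mul_le σ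
  have hH' := mul_le_mul_of_nonneg_left hH hp0.le
  have hL' := mul_le_mul_of_nonneg_left hL (sub_pos.2 hp1).le
  -- Both states of nature have positive weight, so no slack is possible in either.
  cases θ
  · exact le_antisymm hH (le_of_mul_le_mul_left (by linarith) hp0)
  · exact le_antisymm hL (le_of_mul_le_mul_left (by linarith) (sub_pos.2 hp1))

/-- The probability of action `H` is the same for all best responses in each state, so the
receiver's payoff varies only through the probability that the game ends in state `L`. -/
theorem receiverPayoff_of_mem_bestResponses (hp0 : 0 < p) (hp1 : p < 1)
    (hv : ∀ θ, IsValue (transition E P θ) (fun i => (P.a i : ℝ)) (v θ))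
    (hσ : σ ∈ bestResponses E p P) :
    receiverPayoff E p P σ = p * ∑ i, P.g.1 i * v Nature.H i
      + (1 - p) * (∑ i, endProb E P σ Nature.L i - ∑ i, P.g.1 i * v Nature.L i) := by
  unfold receiverPayoff
  simp only [mul_sub, mul_one, Finset.sum_sub_distrib]
  rw [sum_endProb_of_mem_bestResponses hp0 hp1 hv hσ,
    sum_endProb_of_mem_bestResponses hp0 hp1 hv hσ]

theorem receiverPayoff_le_of_mem_bestResponses (hp0 : 0 < p) (hp1 : p < 1)
    (hv : ∀ θ, IsValue (transition E P θ) (fun i => (P.a i : ℝ)) (v θ))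
    (hσ : σ ∈ bestResponses E p P) :
    receiverPayoff E p P σ
      ≤ ∑ i, P.g.1 i * (p * v Nature.H i + (1 - p) * (1 - v Nature.L i)) := by
  rw [receiverPayoff_of_mem_bestResponses hp0 hp1 hv hσ]
  have h : ∑ i, P.g.1 i * (p * v Nature.H i + (1 - p) * (1 - v Nature.L i))
      = p * ∑ i, P.g.1 i * v Nature.H i + (1 - p) * (∑ i, P.g.1 i - ∑ i, P.g.1 i * v Nature.L i) := by
    rw [← Finset.sum_sub_distrib, Finset.mul_sum, Finset.mul_sum, ← Finset.sum_add_distrib]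
    exact Finset.sum_congr rfl fun i _ => by ring
  rw [h, P.g.2.2]
  have := mul_le_mul_of_nonneg_left (sum_endProb_le_one E P σ Nature.L) (sub_pos.2 hp1).le
  linarith

/-- If the absorbing states are reached from everywhere, all best responses give the receiver the
same payoff. -/
theorem receiverPayoffs_eq_singleton (hp0 : 0 < p) (hp1 : p < 1)
    (hv : ∀ θ, IsValue (transition E P θ) (fun i => (P.a i : ℝ)) (v θ)) {D : Set M}
    (hD : Escapes (transition E P Nature.L) D) (hD' : ∀ i ∈ D, P.Absorbing i) :
    receiverPayoffs E p P = {p * ∑ i, P.g.1 i * v Nature.H i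
      + (1 - p) * (1 - ∑ i, P.g.1 i * v Nature.L i)} := by
  have h : ∀ σ ∈ bestResponses E p P, receiverPayoff E p P σ = p * ∑ i, P.g.1 i * v Nature.H i
      + (1 - p) * (1 - ∑ i, P.g.1 i * v Nature.L i) := by
    intro σ hσ
    rw [receiverPayoff_of_mem_bestResponses hp0 hp1 hv hσ,
      sum_endProb_eq_one hD fun i hi => by rw [endRate, if_pos (hD' i hi)]]
  refine Set.eq_singleton_iff_nonempty_unique_mem.2
    ⟨(bestResponses_nonempty E P hp0 hp1).image _, ?_⟩
  rintro _ ⟨σ, hσ, rfl⟩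
  exact h σ hσ

end Play

/-! ### Extreme likelihood ratios -/

section Experiment

variable {S : Type*} [Fintype S]

theorem Experiment.ratio_pos (E : Experiment S) (s : S) : 0 < E.ratio s :=
  div_pos (E.prob_pos _ s) (E.prob_pos _ s)

theorem Experiment.exists_extreme (E : Experiment S) :
    ∃ s₁ s₂, (∀ s, E.ratio s₁ ≤ E.ratio s) ∧ (∀ s, E.ratio s ≤ E.ratio s₂) ∧
      E.gamma = E.ratio s₂ / E.ratio s₁ := by
  have : Nonempty S := by
    by_contra h
    rw [not_nonempty_iff] at h
    simpa using E.prob_sum Nature.H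
  obtain ⟨s₁, h₁⟩ := exists_eq_ciInf_of_finite (f := E.ratio)
  obtain ⟨s₂, h₂⟩ := exists_eq_ciSup_of_finite (f := E.ratio)
  refine ⟨s₁, s₂, fun s => ?_, fun s => ?_, ?_⟩
  · rw [h₁]; exact ciInf_le (Set.finite_range _).bddBelow s
  · rw [h₂]; exact le_ciSup (Set.finite_range _).bddAbove s
  · rw [Experiment.gamma, h₁, h₂]

theorem Experiment.one_le_gamma (E : Experiment S) : 1 ≤ E.gamma := by
  obtain ⟨s₁, s₂, h₁, -, h⟩ := E.exists_extreme
  rw [h, one_le_div (E.ratio_pos s₁)]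
  exact h₁ s₂

theorem Experiment.ratio_mul (E : Experiment S) (s : S) :
    E.ratio s * E.prob Nature.L s = E.prob Nature.H s :=
  div_mul_cancel₀ _ (E.prob_pos _ s).ne'

end Experiment

/-! ### Maximizing the receiver's payoff under an odds constraint -/

section Optimum

theorem skewness_lt_iff {p G : ℝ} (hp0 : 0 < p) (hp1 : p < 1) :
    skewness p < G ↔ p < G * (1 - p) ∧ 1 - p < G * p := by
  rw [skewness, max_lt_iff, div_lt_iff₀ (sub_pos.2 hp1), div_lt_iff₀ hp0]

theorem skewness_ge_one {p : ℝ} (hp0 : 0 < p) (hp1 : p < 1) : 1 ≤ skewness p := by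
  by_contra! h
  have := (skewness_lt_iff hp0 hp1).1 h
  linarith

variable {p G x y : ℝ}

/-- The constraint implies the linear bounds `x ≤ G * y` and `1 - y ≤ G * (1 - x)`. For `G` below
the skewness, one of them shows that a constant action does at least as well. -/
theorem payoff_le_of_odds_of_le (hp0 : 0 < p) (hp1 : p < 1) (hG : G ≤ skewness p) (hG1 : 1 ≤ G)
    (hx0 : 0 ≤ x) (hx1 : x ≤ 1) (hy0 : 0 ≤ y) (hy1 : y ≤ 1)
    (h : x * (1 - y) ≤ G * ((1 - x) * y)) : p * x + (1 - p) * (1 - y) ≤ max p (1 - p) := by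
  have h1 : 0 ≤ (G - 1) * (x * y) := mul_nonneg (sub_nonneg.2 hG1) (mul_nonneg hx0 hy0)
  have h2 : 0 ≤ (G - 1) * ((1 - x) * (1 - y)) :=
    mul_nonneg (sub_nonneg.2 hG1) (mul_nonneg (sub_nonneg.2 hx1) (sub_nonneg.2 hy1))
  have h3 : x ≤ G * y := by linarith
  have h4 : 1 - y ≤ G * (1 - x) := by linarith
  rw [← not_lt, skewness_lt_iff hp0 hp1, not_and_or, not_lt, not_lt] at hG
  rcases hG with hG | hG
  · refine le_max_of_le_left ?_
    have h5 := mul_le_mul_of_nonneg_left h4 (sub_pos.2 hp1).le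
    have h6 := mul_le_mul_of_nonneg_right hG (sub_nonneg.2 hx1)
    linarith
  · refine le_max_of_le_right ?_
    have h5 := mul_le_mul_of_nonneg_left h3 hp0.le
    have h6 := mul_le_mul_of_nonneg_right hG hy0
    linarith

/-- The odds constraint is equivalent to `G ≤ ((G - 1) * (1 - x) + 1) * ((G - 1) * y + 1)`; then
AM-GM applies to the two factors weighted by `p` and `1 - p`. -/
theorem two_sqrt_le (hp0 : 0 < p) (hp1 : p < 1) (hG1 : 1 < G)
    (hx1 : x ≤ 1) (hy0 : 0 ≤ y) (h : x * (1 - y) ≤ G * ((1 - x) * y)) :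
    2 * √(p * (1 - p) * G) ≤ p * ((G - 1) * (1 - x) + 1) + (1 - p) * ((G - 1) * y + 1) := by
  have hA : 0 ≤ p * ((G - 1) * (1 - x) + 1) := mul_nonneg hp0.le
    (add_nonneg (mul_nonneg (sub_pos.2 hG1).le (sub_nonneg.2 hx1)) zero_le_one)
  have hB : 0 ≤ (1 - p) * ((G - 1) * y + 1) := mul_nonneg (sub_pos.2 hp1).le
    (add_nonneg (mul_nonneg (sub_pos.2 hG1).le hy0) zero_le_one)
  have hAB : G ≤ ((G - 1) * (1 - x) + 1) * ((G - 1) * y + 1) := by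
    have := mul_le_mul_of_nonneg_left h (sub_pos.2 hG1).le
    linarith
  have hle := mul_le_mul_of_nonneg_left hAB (mul_pos hp0 (sub_pos.2 hp1)).le
  rw [← le_div_iff₀' two_pos]
  refine Real.sqrt_le_iff.2 ⟨by positivity, ?_⟩
  nlinarith [sq_nonneg (p * ((G - 1) * (1 - x) + 1) - (1 - p) * ((G - 1) * y + 1))]

theorem two_sqrt_lt (hp0 : 0 < p) (hp1 : p < 1) (hG1 : 1 < G)
    (hx1 : x ≤ 1) (hy0 : 0 ≤ y) (h : x * (1 - y) < G * ((1 - x) * y)) :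
    2 * √(p * (1 - p) * G) < p * ((G - 1) * (1 - x) + 1) + (1 - p) * ((G - 1) * y + 1) := by
  have hA : 0 < p * ((G - 1) * (1 - x) + 1) := mul_pos hp0
    (add_pos_of_nonneg_of_pos (mul_nonneg (sub_pos.2 hG1).le (sub_nonneg.2 hx1)) zero_lt_one)
  have hB : 0 < (1 - p) * ((G - 1) * y + 1) := mul_pos (sub_pos.2 hp1)
    (add_pos_of_nonneg_of_pos (mul_nonneg (sub_pos.2 hG1).le hy0) zero_lt_one)
  have hAB : G < ((G - 1) * (1 - x) + 1) * ((G - 1) * y + 1) := by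
    have := mul_lt_mul_of_pos_left h (sub_pos.2 hG1)
    linarith
  have hlt := mul_lt_mul_of_pos_left hAB (mul_pos hp0 (sub_pos.2 hp1))
  rw [← lt_div_iff₀' two_pos]
  refine (Real.sqrt_lt' (by positivity)).2 ?_
  nlinarith [sq_nonneg (p * ((G - 1) * (1 - x) + 1) - (1 - p) * ((G - 1) * y + 1))]

theorem payoff_le_of_odds (hp0 : 0 < p) (hp1 : p < 1) (hG1 : 1 < G)
    (hx1 : x ≤ 1) (hy0 : 0 ≤ y) (h : x * (1 - y) ≤ G * ((1 - x) * y)) :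
    p * x + (1 - p) * (1 - y) ≤ 1 - (2 * √(p * (1 - p) * G) - 1) / (G - 1) := by
  have h1 := two_sqrt_le hp0 hp1 hG1 hx1 hy0 h
  have h2 : (2 * √(p * (1 - p) * G) - 1) / (G - 1) ≤ p * (1 - x) + (1 - p) * y := by
    rw [div_le_iff₀ (sub_pos.2 hG1)]
    linarith
  linarith

theorem payoff_lt_of_odds (hp0 : 0 < p) (hp1 : p < 1) (hG1 : 1 < G)
    (hx1 : x ≤ 1) (hy0 : 0 ≤ y) (h : x * (1 - y) < G * ((1 - x) * y)) :
    p * x + (1 - p) * (1 - y) < 1 - (2 * √(p * (1 - p) * G) - 1) / (G - 1) := by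
  have h1 := two_sqrt_lt hp0 hp1 hG1 hx1 hy0 h
  have h2 : (2 * √(p * (1 - p) * G) - 1) / (G - 1) < p * (1 - x) + (1 - p) * y := by
    rw [div_lt_iff₀ (sub_pos.2 hG1)]
    linarith
  linarith

/-- Strict AM-GM for `p` and `G * (1 - p)`, and for `1 - p` and `G * p`; the condition on the
skewness says exactly that `p` and `1 - p` are the smaller terms. -/
theorem max_lt_optimum (hp0 : 0 < p) (hp1 : p < 1) (hG : skewness p < G) :
    max p (1 - p) < 1 - (2 * √(p * (1 - p) * G) - 1) / (G - 1) := by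
  have hG1 := (skewness_ge_one hp0 hp1).trans_lt hG
  obtain ⟨h1, h2⟩ := (skewness_lt_iff hp0 hp1).1 hG
  have hp : 2 * √(p * (1 - p) * G) < p + G * (1 - p) := by
    rw [← lt_div_iff₀' two_pos]
    refine (Real.sqrt_lt' (by linarith)).2 ?_
    nlinarith [mul_pos (sub_pos.2 h1) (sub_pos.2 h1)]
  have hq : 2 * √(p * (1 - p) * G) < (1 - p) + G * p := by
    rw [← lt_div_iff₀' two_pos]
    refine (Real.sqrt_lt' (by linarith)).2 ?_
    nlinarith [mul_pos (sub_pos.2 h2) (sub_pos.2 h2)]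
  refine max_lt ?_ ?_
  · rw [lt_sub_comm, div_lt_iff₀ (sub_pos.2 hG1)]
    linarith
  · rw [lt_sub_comm, div_lt_iff₀ (sub_pos.2 hG1)]
    linarith

/-- In the interior, a strict bound on the odds gives a strict bound on the payoff; at the
boundary the payoff does not exceed the payoff from a constant action. -/
theorem payoff_lt_of_odds_interior (hp0 : 0 < p) (hp1 : p < 1) (hG : skewness p < G)
    (hx0 : 0 ≤ x) (hx1 : x ≤ 1) (hy0 : 0 ≤ y) (hy1 : y ≤ 1)
    (h : x * (1 - y) ≤ G * ((1 - x) * y))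
    (h' : 0 < x → x < 1 → 0 < y → y < 1 → x * (1 - y) < G * ((1 - x) * y)) :
    p * x + (1 - p) * (1 - y) < 1 - (2 * √(p * (1 - p) * G) - 1) / (G - 1) := by
  have hG1 := (skewness_ge_one hp0 hp1).trans_lt hG
  have hV := max_lt_optimum hp0 hp1 hG
  have hVp := (le_max_left _ _).trans_lt hV
  have hVq := (le_max_right _ _).trans_lt hV
  have hq := sub_pos.2 hp1
  rcases hx0.eq_or_lt with rfl | hx0
  · refine lt_of_le_of_lt ?_ hVq
    have := mul_nonneg hq.le hy0
    linarith
  rcases hy1.eq_or_lt with rfl | hy1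
  · refine lt_of_le_of_lt ?_ hVp
    have := mul_le_mul_of_nonneg_left hx1 hp0.le
    linarith
  rcases hx1.eq_or_lt with rfl | hx1
  · linarith
  rcases hy0.eq_or_lt with rfl | hy0
  · linarith
  · exact payoff_lt_of_odds hp0 hp1 hG1 hx1.le hy0.le (h' hx0 hx1 hy0 hy1)

theorem payoff_le_optimalPayoff {γ : ℝ} {m : ℕ} (hp0 : 0 < p) (hp1 : p < 1) (hγ : 1 ≤ γ)
    (hx0 : 0 ≤ x) (hx1 : x ≤ 1) (hy0 : 0 ≤ y) (hy1 : y ≤ 1)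
    (h : x * (1 - y) ≤ γ ^ (m - 2) * ((1 - x) * y)) :
    p * x + (1 - p) * (1 - y) ≤ optimalPayoff p γ m := by
  unfold optimalPayoff
  split_ifs with hG
  · exact payoff_le_of_odds hp0 hp1 ((skewness_ge_one hp0 hp1).trans_lt hG) hx1 hy0 h
  · exact payoff_le_of_odds_of_le hp0 hp1 (not_lt.1 hG) (one_le_pow₀ hγ) hx0 hx1 hy0 hy1 h

end Optimum

/-! ### The upper bound and non-attainment -/

section UpperBound

variable {S M : Type*} [Fintype S] [Fintype M] {E : Experiment S} {P : Protocol S M}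

theorem Escapes.nonempty {M : Type*} {Q : M → M → ℝ} {D : Set M} (hD : Escapes Q D) (i : M) : D.Nonempty := by
  by_contra h
  rw [Set.not_nonempty_iff_eq_empty] at h
  obtain ⟨-, -, j, hj, -⟩ := hD Set.univ ⟨i, trivial⟩ (by simp [h])
  exact hj trivial

theorem mul_transition_le {r : ℝ} (hr : ∀ s, r ≤ E.ratio s) (i j : M) :
    r * transition E P Nature.L i j ≤ transition E P Nature.H i j := by
  unfold transition
  rw [Finset.mul_sum]
  refine Finset.sum_le_sum fun s _ => ?_
  rw [← mul_assoc]
  refine mul_le_mul_of_nonneg_right ?_ ((P.f i s).2.1 j)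
  rw [← E.ratio_mul s]
  exact mul_le_mul_of_nonneg_right (hr s) (E.prob_pos _ s).le

theorem transition_le_mul {r : ℝ} (hr : ∀ s, E.ratio s ≤ r) (i j : M) :
    transition E P Nature.H i j ≤ r * transition E P Nature.L i j := by
  unfold transition
  rw [Finset.mul_sum]
  refine Finset.sum_le_sum fun s _ => ?_
  rw [← mul_assoc]
  refine mul_le_mul_of_nonneg_right ?_ ((P.f i s).2.1 j)
  rw [← E.ratio_mul s]
  exact mul_le_mul_of_nonneg_right (hr s) (E.prob_pos _ s).le

theorem transition_pos {θ θ' : Nature} {i j : M} (h : 0 < transition E P θ i j) :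
    0 < transition E P θ' i j := by
  obtain ⟨s, -, hs⟩ := Finset.exists_lt_of_sum_lt
    (s := Finset.univ) (f := fun _ : S => (0 : ℝ)) (by simpa [transition] using h)
  refine Finset.sum_pos' (fun s _ => mul_nonneg (E.prob_pos θ' s).le ((P.f i s).2.1 j))
    ⟨s, Finset.mem_univ s, mul_pos (E.prob_pos θ' s) (pos_of_mul_pos_right hs (E.prob_pos θ s).le)⟩

variable {vH vL : M → ℝ}

/-- The odds of action `H` in the two states of nature differ by a factor of at most
`γ ^ (m - 2)`, after a decrease of the sender's payoff in state `L`. -/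
theorem exists_odds_bound (hH : IsValue (transition E P Nature.H) (fun i => (P.a i : ℝ)) vH)
    (hL : IsValue (transition E P Nature.L) (fun i => (P.a i : ℝ)) vL) (i : M) :
    ∃ y, 0 ≤ y ∧ y ≤ 1 ∧ y ≤ vL i ∧ 0 ≤ vH i ∧ vH i ≤ 1 ∧
      vH i * (1 - y) ≤ E.gamma ^ (Fintype.card M - 2) * ((1 - vH i) * y) ∧
      (1 < E.gamma → 4 ≤ Fintype.card M → 0 < vH i → vH i < 1 → 0 < y → y < 1 →
        vH i * (1 - y) < E.gamma ^ (Fintype.card M - 2) * ((1 - vH i) * y)) := by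
  classical
  obtain ⟨s₁, s₂, hs₁, hs₂, hγ⟩ := E.exists_extreme
  have hr₁ := E.ratio_pos s₁
  have hr₂ := E.ratio_pos s₂
  have hγ1 := E.one_le_gamma
  set r₁ := E.ratio s₁
  set r₂ := E.ratio s₂
  set D : Set M := {i | vH i = P.a i}
  have ha : ∀ i, 0 ≤ (P.a i : ℝ) := fun i => (P.a i).2.1
  have ha' : ∀ i, (P.a i : ℝ) ≤ 1 := fun i => (P.a i).2.2
  have hPH := isStochastic_transition E P Nature.H
  have hPL := isStochastic_transition E P Nature.L
  have hDH : Escapes (transition E P Nature.H) D := hH.escapes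
  have hDL : Escapes (transition E P Nature.L) D := hDH.of_support fun i _ j h => transition_pos h
  have hu' : IsHarmonicExt (transition E P Nature.H) D (fun i => (P.a i : ℝ)) vH := hH.isHarmonicExt
  obtain ⟨u, hu⟩ := hPL.exists_harmonicExt hDL fun i => (P.a i : ℝ)
  have hu0 := hu.nonneg hPL hDL (fun i _ => ha i) i
  have hu1 := hu.mono (hPL.isHarmonicExt_const D 1) hPL hDL (fun i _ => ha' i) i
  have hv0 := hu'.nonneg hPH hDH (fun i _ => ha i) i
  have hv1 := hu'.mono (hPH.isHarmonicExt_const D 1) hPH hDH (fun i _ => ha' i) i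
  have huv := mul_nonneg (sub_nonneg.2 hv1) hu0
  -- The witness is the sender's payoff in state `L` from imitating the stopping set of state `H`.
  refine ⟨u i, hu0, hu1, hL.harmonicExt_le hPL hDL hu i, hv0, hv1, ?_⟩
  obtain ⟨d, hd⟩ := hDH.nonempty i
  by_cases hsub : D = {d}
  · -- a single stopping state: both payoffs are equal
    have key : ∀ {Q : M → M → ℝ} {w : M → ℝ}, IsStochastic Q → Escapes Q D →
        IsHarmonicExt Q D (fun i => (P.a i : ℝ)) w → w i = P.a d := fun hQ hDQ hw =>
      hw.unique (hQ.isHarmonicExt_const D (P.a d : ℝ)) hQ hDQ (fun j hj => by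
        rw [hsub, Set.mem_singleton_iff] at hj
        rw [hj]) i
    have heq : vH i = u i := (key hPH hDH hu').trans (key hPL hDL hu).symm
    rw [heq] at huv ⊢
    constructor
    · rw [mul_comm (u i)]
      exact le_mul_of_one_le_left huv (one_le_pow₀ hγ1)
    · intro hγ1' hm h1 h2 _ _
      rw [mul_comm (u i)]
      exact lt_mul_of_one_lt_left (mul_pos (sub_pos.2 h2) h1) (one_lt_pow₀ hγ1' (by omega))
  · obtain ⟨e, he, hed⟩ : ∃ e ∈ D, e ≠ d := by
      by_contra! h
      exact hsub (Set.eq_singleton_iff_unique_mem.2 ⟨hd, h⟩)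
    set T : Finset M := Finset.univ.filter fun i => i ∉ D with hTdef
    have hT : ∀ i, i ∈ T ↔ i ∉ D := fun i => by simp [hTdef]
    have hcard : T.card ≤ Fintype.card M - 2 := by
      have h1 : T ⊆ (Finset.univ.erase d).erase e := fun i hi => by
        have hi := (hT i).1 hi
        refine Finset.mem_erase.2 ⟨fun h => hi (h ▸ he), Finset.mem_erase.2
          ⟨fun h => hi (h ▸ hd), Finset.mem_univ i⟩⟩
      have h2 := Finset.card_le_card h1
      rw [Finset.card_erase_of_mem (Finset.mem_erase.2 ⟨hed, Finset.mem_univ e⟩),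
        Finset.card_erase_of_mem (Finset.mem_univ d), Finset.card_univ] at h2
      omega
    have hodds := rows_change_odds hPL hDL hr₁ hr₂ ha ha' hu T (fun i hi => (hT i).1 hi) hPH
      (fun i hiD hiT => absurd ((hT i).2 hiD) hiT) (fun i _ j => mul_transition_le hs₁ i j)
      (fun i _ j => transition_le_mul hs₂ i j) hu' i
    rw [← hγ] at hodds
    constructor
    · exact hodds.trans (mul_le_mul_of_nonneg_right (pow_le_pow_right₀ hγ1 hcard) huv)
    · intro hγ1' hm h1 h2 h3 h4
      -- With fewer than `m - 2` states outside `D`, strictness comes from the exponent; with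
      -- exactly `m - 2 ≥ 2`, from the equality case.
      rcases hcard.eq_or_lt with hc | hc
      · have hr : r₁ < r₂ := by rwa [hγ, one_lt_div hr₁] at hγ1'
        have := rows_change_odds_lt hPL hDL hr₁ hr ha ha' hu T hT (by omega) hPH
          (fun i _ j => mul_transition_le hs₁ i j) (fun i _ j => transition_le_mul hs₂ i j) hu'
          h3 h4 h1
        rwa [← hγ, hc] at this
      · exact hodds.trans_lt (mul_lt_mul_of_pos_right (pow_lt_pow_right₀ hγ1' hc)
          (mul_pos (sub_pos.2 h2) h3))

variable {p : ℝ}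

theorem receiverPayoff_le_optimalPayoff (hp0 : 0 < p) (hp1 : p < 1) {σ : Strategy M}
    (hσ : σ ∈ bestResponses E p P) :
    receiverPayoff E p P σ ≤ optimalPayoff p E.gamma (Fintype.card M) := by
  choose v hv using fun θ => (isStochastic_transition E P θ).exists_isValue fun i => (P.a i).2.2
  refine (receiverPayoff_le_of_mem_bestResponses hp0 hp1 hv hσ).trans ?_
  calc ∑ i, P.g.1 i * (p * v Nature.H i + (1 - p) * (1 - v Nature.L i))
      ≤ ∑ i, P.g.1 i * optimalPayoff p E.gamma (Fintype.card M) := by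
        refine Finset.sum_le_sum fun i _ => mul_le_mul_of_nonneg_left ?_ (P.g.2.1 i)
        obtain ⟨y, hy0, hy1, hyv, hx0, hx1, h, -⟩ := exists_odds_bound (hv _) (hv _) i
        refine le_trans ?_ (payoff_le_optimalPayoff hp0 hp1 E.one_le_gamma hx0 hx1 hy0 hy1 h)
        have := mul_le_mul_of_nonneg_left hyv (sub_pos.2 hp1).le
        linarith
    _ = optimalPayoff p E.gamma (Fintype.card M) := by
        rw [← Finset.sum_mul, P.g.2.2, one_mul]

/-- With at least four states, the payoffs from a protocol are bounded away from the optimum. -/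
theorem exists_receiverPayoff_le_lt (P : Protocol S M) (hp0 : 0 < p) (hp1 : p < 1)
    (hm : 4 ≤ Fintype.card M) (hG : skewness p < E.gamma ^ (Fintype.card M - 2)) :
    ∃ b < optimalPayoff p E.gamma (Fintype.card M), ∀ σ ∈ bestResponses E p P,
      receiverPayoff E p P σ ≤ b := by
  choose v hv using fun θ => (isStochastic_transition E P θ).exists_isValue fun i => (P.a i).2.2
  -- One bound, depending only on the value functions, serves all best responses; hence even their
  -- supremum stays below the optimum.
  refine ⟨_, ?_, fun σ hσ => receiverPayoff_le_of_mem_bestResponses hp0 hp1 hv hσ⟩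
  have hγ : 1 < E.gamma := by
    refine lt_of_le_of_ne E.one_le_gamma fun h => ?_
    rw [← h, one_pow] at hG
    exact absurd hG (not_lt.2 (skewness_ge_one hp0 hp1))
  have hlt : ∀ i, p * v Nature.H i + (1 - p) * (1 - v Nature.L i)
      < optimalPayoff p E.gamma (Fintype.card M) := by
    intro i
    obtain ⟨y, hy0, hy1, hyv, hx0, hx1, h, h'⟩ := exists_odds_bound (hv _) (hv _) i
    rw [optimalPayoff, if_pos hG]
    refine lt_of_le_of_lt ?_ (payoff_lt_of_odds_interior hp0 hp1 hG hx0 hx1 hy0 hy1 h (h' hγ hm))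
    have := mul_le_mul_of_nonneg_left hyv (sub_pos.2 hp1).le
    linarith
  calc ∑ i, P.g.1 i * (p * v Nature.H i + (1 - p) * (1 - v Nature.L i))
      < ∑ i, P.g.1 i * optimalPayoff p E.gamma (Fintype.card M) := by
        obtain ⟨i, -, hi⟩ := Finset.exists_lt_of_sum_lt
          (s := Finset.univ) (f := fun _ : M => (0 : ℝ)) (g := P.g.1) (by simp [P.g.2.2])
        exact Finset.sum_lt_sum
          (fun i _ => mul_le_mul_of_nonneg_left (hlt i).le (P.g.2.1 i))
          ⟨i, Finset.mem_univ i, mul_lt_mul_of_pos_left (hlt i) hi⟩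
    _ = optimalPayoff p E.gamma (Fintype.card M) := by
        rw [← Finset.sum_mul, P.g.2.2, one_mul]

end UpperBound

/-! ### Nearly optimal protocols: gambler's ruin with rare exits -/

section Construction

/-- Move to `j` with probability `q`, stay in `i` otherwise. -/
noncomputable def moveTo {M : Type*} [Fintype M] [DecidableEq M] (q : unitInterval) (j i : M) :
    stdSimplex ℝ M :=
  ⟨fun l => q * Pi.single (M := fun _ => ℝ) j 1 l + (1 - q) * Pi.single (M := fun _ => ℝ) i 1 l,
    fun l => add_nonneg
      (mul_nonneg q.2.1 ((single_mem_stdSimplex ℝ j).1 l))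
      (mul_nonneg (sub_nonneg.2 q.2.2) ((single_mem_stdSimplex ℝ i).1 l)), by
    rw [Finset.sum_add_distrib, ← Finset.mul_sum, ← Finset.mul_sum,
      (single_mem_stdSimplex ℝ j).2, (single_mem_stdSimplex ℝ i).2]
    ring⟩

theorem sum_moveTo_mul {M : Type*} [Fintype M] [DecidableEq M] (q : unitInterval) (j i : M)
    (u : M → ℝ) : ∑ l, (moveTo q j i).1 l * u l = u i + q * (u j - u i) := by
  simp only [moveTo, add_mul, Finset.sum_add_distrib, mul_assoc, ← Finset.mul_sum,
    Pi.single_apply, ite_mul, one_mul, zero_mul, Finset.sum_ite_eq', Finset.mem_univ, if_true]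
  ring

variable {S : Type*}

/-- The state above `i`. -/
def above {n : ℕ} (i : Fin (n + 3)) : Fin (n + 3) := ⟨min (i + 1) (n + 2), by omega⟩

/-- The state below `i`. -/
def below {n : ℕ} (i : Fin (n + 3)) : Fin (n + 3) := ⟨i - 1, by omega⟩

open Classical in
/-- A birth-death protocol with absorbing states `0` and `n + 2`: the signal `s₂` moves the memory
up and the signal `s₁` moves it down, with probabilities `b i` and `d i`. -/
noncomputable def ruinProtocol (s₁ s₂ : S) (n : ℕ) (b d : Fin (n + 3) → unitInterval) :
    Protocol S (Fin (n + 3)) where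
  f i s := if i = 0 ∨ i = Fin.last (n + 2) then moveTo 0 i i
    else if s = s₂ then moveTo (b i) (above i) i
    else if s = s₁ then moveTo (d i) (below i) i
    else moveTo 0 i i
  g := ⟨Pi.single 1 1, single_mem_stdSimplex ℝ 1⟩
  a i := if i = Fin.last (n + 2) then 1 else 0

theorem ruinProtocol_absorbing {s₁ s₂ : S} {n : ℕ} {b d : Fin (n + 3) → unitInterval}
    {i : Fin (n + 3)} (hi : i = 0 ∨ i = Fin.last (n + 2)) :
    (ruinProtocol s₁ s₂ n b d).Absorbing i := by
  intro s
  simp [ruinProtocol, hi, moveTo]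

variable [Fintype S] {E : Experiment S} {s₁ s₂ : S} {n : ℕ} {b d : Fin (n + 3) → unitInterval}

theorem sum_transition_mul {M : Type*} [Fintype M] (E : Experiment S) (P : Protocol S M)
    (θ : Nature) (i : M) (u : M → ℝ) :
    ∑ j, transition E P θ i j * u j = ∑ s, E.prob θ s * ∑ j, (P.f i s).1 j * u j := by
  simp only [transition, Finset.sum_mul, Finset.mul_sum]
  rw [Finset.sum_comm]
  exact Finset.sum_congr rfl fun s _ => Finset.sum_congr rfl fun j _ => by ring

theorem sum_ruin_transition_absorbing (θ : Nature) {i : Fin (n + 3)}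
    (hi : i = 0 ∨ i = Fin.last (n + 2)) (u : Fin (n + 3) → ℝ) :
    ∑ j, transition E (ruinProtocol s₁ s₂ n b d) θ i j * u j = u i := by
  rw [sum_transition_mul]
  simp only [ruinProtocol, if_pos hi, sum_moveTo_mul]
  simp [← Finset.sum_mul, E.prob_sum]

theorem sum_ruin_transition (hs : s₁ ≠ s₂) (θ : Nature) {i : Fin (n + 3)}
    (hi : ¬ (i = 0 ∨ i = Fin.last (n + 2))) (u : Fin (n + 3) → ℝ) :
    ∑ j, transition E (ruinProtocol s₁ s₂ n b d) θ i j * u j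
      = u i + E.prob θ s₂ * b i * (u (above i) - u i) - E.prob θ s₁ * d i * (u i - u (below i)) := by
  classical
  rw [sum_transition_mul]
  have h : ∀ s, E.prob θ s * ∑ j, ((ruinProtocol s₁ s₂ n b d).f i s).1 j * u j
      = E.prob θ s * u i + (if s = s₂ then E.prob θ s₂ * b i * (u (above i) - u i) else 0)
        + (if s = s₁ then - (E.prob θ s₁ * d i * (u i - u (below i))) else 0) := by
    intro s
    simp only [ruinProtocol, if_neg hi]
    by_cases h2 : s = s₂
    · subst h2
      simp only [if_true, if_neg hs.symm, sum_moveTo_mul]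
      ring
    · by_cases h1 : s = s₁
      · subst h1
        simp only [if_true, if_neg h2, sum_moveTo_mul]
        ring
      · simp only [if_neg h1, if_neg h2, sum_moveTo_mul]
        simp
  simp_rw [h, Finset.sum_add_distrib]
  rw [← Finset.sum_mul, E.prob_sum]
  simp only [Finset.sum_ite_eq', Finset.mem_univ, if_true]
  ring

/-- The largest element of a set of interior states has an upward transition out of the set. -/
theorem ruin_escapes (hb : ∀ i, 0 < (b i : ℝ)) (θ : Nature) :
    Escapes (transition E (ruinProtocol s₁ s₂ n b d) θ) {i | i = 0 ∨ i = Fin.last (n + 2)} := by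
  intro T hT hTD
  obtain ⟨i, hi, hmax⟩ := T.toFinite.toFinset.exists_max_image id (by simpa using hT)
  rw [Set.Finite.mem_toFinset] at hi
  have hiD : ¬ (i = 0 ∨ i = Fin.last (n + 2)) := Set.disjoint_left.1 hTD hi
  have hlt : i < above i := by
    have : i.1 ≠ n + 2 := fun h => hiD (Or.inr (Fin.ext h))
    rw [Fin.lt_def]
    simp only [above]
    omega
  refine ⟨i, hi, above i, fun h => ?_, ?_⟩
  · exact absurd (hmax (above i) (by simpa using h)) (not_le.2 hlt)
  · refine Finset.sum_pos' (fun s _ => mul_nonneg (E.prob_pos θ s).le (((ruinProtocol s₁ s₂ n b d).f i s).2.1 _))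
      ⟨s₂, Finset.mem_univ s₂, mul_pos (E.prob_pos θ s₂) ?_⟩
    simp only [ruinProtocol, if_neg hiD, if_true, moveTo, Pi.single_eq_same,
      Pi.single_eq_of_ne hlt.ne', mul_one, mul_zero, add_zero]
    exact hb i

/-- The increments of the harmonic function of the birth-death chain, up to normalization. -/
noncomputable def ruinStep (ρ k δ : ℝ) (n j : ℕ) : ℝ :=
  if j = 0 then 1 else if j ≤ n then δ * ρ ^ j else ρ ^ (n + 1) / k

/-- The sum of all increments. -/
noncomputable def ruinSum (ρ k δ : ℝ) (n : ℕ) : ℝ :=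
  ∑ j ∈ Finset.range (n + 2), ruinStep ρ k δ n j

theorem ruinStep_nonneg {ρ k δ : ℝ} (hρ : 0 < ρ) (hk : 0 < k) (hδ : 0 ≤ δ) (n j : ℕ) :
    0 ≤ ruinStep ρ k δ n j := by
  unfold ruinStep
  split_ifs <;> positivity

theorem ruinSum_pos {ρ k δ : ℝ} (hρ : 0 < ρ) (hk : 0 < k) (hδ : 0 ≤ δ) (n : ℕ) :
    0 < ruinSum ρ k δ n :=
  Finset.sum_pos' (fun j _ => ruinStep_nonneg hρ hk hδ n j)
    ⟨0, by simp, by simp [ruinStep]⟩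

/-- The sum is affine in `δ`, and at `δ = 0` only the first and last increments survive. -/
theorem tendsto_ruinSum (ρ k : ℝ) (n : ℕ) :
    Tendsto (fun δ => ruinSum ρ k δ n) (𝓝[>] 0) (𝓝 (1 + ρ ^ (n + 1) / k)) := by
  have h0 : ruinSum ρ k 0 n = 1 + ρ ^ (n + 1) / k := by
    rw [ruinSum, Finset.sum_range_succ, Finset.sum_range_succ', Finset.sum_eq_zero]
    · simp [ruinStep]
    · intro j hj
      have : j + 1 ≤ n := by simpa using hj
      simp [ruinStep, this]
  have hc : Continuous fun δ => ruinSum ρ k δ n := by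
    refine continuous_finsetSum _ fun j _ => ?_
    unfold ruinStep
    split_ifs <;> fun_prop
  rw [← h0]
  exact (hc.tendsto 0).mono_left nhdsWithin_le_nhds

/-- The value functions of the birth-death protocol. -/
theorem ruin_isValue (hs : s₁ ≠ s₂) {k δ : ℝ} (hk : 0 < k) (hδ : 0 < δ)
    (hb : ∀ i, 0 < (b i : ℝ))
    (hb' : ∀ i : Fin (n + 3), (b i : ℝ) = if i.1 = n + 1 then δ * k else 1)
    (hd : ∀ i : Fin (n + 3), (d i : ℝ) = if i.1 = 1 then δ else 1) (θ : Nature) :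
    IsValue (transition E (ruinProtocol s₁ s₂ n b d) θ)
      (fun i => ((ruinProtocol s₁ s₂ n b d).a i : ℝ))
      (fun i => (∑ j ∈ Finset.range i.1, ruinStep (E.prob θ s₁ / E.prob θ s₂) k δ n j)
        / ruinSum (E.prob θ s₁ / E.prob θ s₂) k δ n) := by
  have h1 := E.prob_pos θ s₁
  have h2 := E.prob_pos θ s₂
  set ρ := E.prob θ s₁ / E.prob θ s₂ with hρ
  have hρ0 : 0 < ρ := div_pos h1 h2
  have hρm : E.prob θ s₁ = E.prob θ s₂ * ρ := by rw [hρ]; field_simp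
  have hS := ruinSum_pos hρ0 hk hδ.le n
  have hharm : ∀ i, ∑ j, transition E (ruinProtocol s₁ s₂ n b d) θ i j *
      ((∑ l ∈ Finset.range j.1, ruinStep ρ k δ n l) / ruinSum ρ k δ n)
      = (∑ l ∈ Finset.range i.1, ruinStep ρ k δ n l) / ruinSum ρ k δ n := by
    intro i
    by_cases hi : i = 0 ∨ i = Fin.last (n + 2)
    · exact sum_ruin_transition_absorbing θ hi
        fun j => (∑ l ∈ Finset.range j.1, ruinStep ρ k δ n l) / ruinSum ρ k δ n
    · rw [sum_ruin_transition hs θ hi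
        fun j => (∑ l ∈ Finset.range j.1, ruinStep ρ k δ n l) / ruinSum ρ k δ n]
      have hi0 : i.1 ≠ 0 := fun h => hi (Or.inl (Fin.ext h))
      have hi1 : i.1 ≠ n + 2 := fun h => hi (Or.inr (Fin.ext h))
      have hi2 := i.2
      obtain ⟨j, hj⟩ : ∃ j, i.1 = j + 1 := ⟨i.1 - 1, by omega⟩
      have ha : (above i).1 = j + 1 + 1 := by simp only [above]; omega
      have hbl : (below i).1 = j := by simp only [below]; omega
      -- The slowed exits are tuned so that up-probability times upper increment is `δ * ρ ^ (j +
      -- 1)` and down-probability times lower increment is `δ * ρ ^ j` at every interior state, ends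
      -- included; harmonicity follows as the signal odds are `ρ`.
      have e1 : (b i : ℝ) * ruinStep ρ k δ n (j + 1) = δ * ρ ^ (j + 1) := by
        rw [hb' i, ruinStep, if_neg (Nat.succ_ne_zero j), hj]
        by_cases h : j = n
        · subst h
          rw [if_pos rfl, if_neg (by omega)]
          field_simp
        · rw [if_neg (by omega), if_pos (by omega), one_mul]
      have e2 : (d i : ℝ) * ruinStep ρ k δ n j = δ * ρ ^ j := by
        rw [hd i, ruinStep, hj]
        by_cases h : j = 0
        · simp [h]
        · rw [if_neg (by omega), if_neg h, if_pos (by omega), one_mul]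
      rw [ha, hbl, hj, Finset.sum_range_succ _ (j + 1), Finset.sum_range_succ _ j, hρm]
      linear_combination (E.prob θ s₂ / ruinSum ρ k δ n) * (e1 - ρ * e2)
  have hnn : ∀ i : Fin (n + 3),
      0 ≤ (∑ l ∈ Finset.range i.1, ruinStep ρ k δ n l) / ruinSum ρ k δ n := fun i =>
    div_nonneg (Finset.sum_nonneg fun j _ => ruinStep_nonneg hρ0 hk hδ.le n j) hS.le
  have hlast : (∑ l ∈ Finset.range (Fin.last (n + 2)).1, ruinStep ρ k δ n l) / ruinSum ρ k δ n = 1 :=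
    div_self hS.ne'
  refine ⟨fun i => ?_, fun i => (hharm i).le, fun i _ => hharm i, (ruin_escapes hb θ).mono ?_⟩
  · by_cases hi : i = Fin.last (n + 2)
    · rw [hi, hlast]
      simp [ruinProtocol]
    · simpa [ruinProtocol, hi] using hnn i
  · rintro i (rfl | rfl)
    · have h0 : (0 : Fin (n + 3)) ≠ Fin.last (n + 2) := Fin.last_pos.ne
      simp [ruinProtocol, h0]
    · rw [Set.mem_ofPred_eq, hlast]
      simp [ruinProtocol]

theorem exists_ruin_payoff (hs : s₁ ≠ s₂) (n : ℕ) {p k δ : ℝ} (hp0 : 0 < p) (hp1 : p < 1)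
    (hk : 0 < k) (hδ : 0 < δ) (hδ1 : δ ≤ 1) (hδk : δ * k ≤ 1) :
    ∃ P : Protocol S (Fin (n + 3)), receiverPayoffs E p P =
      {p * (1 / ruinSum (E.prob Nature.H s₁ / E.prob Nature.H s₂) k δ n)
        + (1 - p) * (1 - 1 / ruinSum (E.prob Nature.L s₁ / E.prob Nature.L s₂) k δ n)} := by
  have hδk0 := mul_pos hδ hk
  let b : Fin (n + 3) → unitInterval := fun i =>
    if i.1 = n + 1 then ⟨δ * k, hδk0.le, hδk⟩ else 1
  let d : Fin (n + 3) → unitInterval := fun i => if i.1 = 1 then ⟨δ, hδ.le, hδ1⟩ else 1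
  have hb' : ∀ i : Fin (n + 3), (b i : ℝ) = if i.1 = n + 1 then δ * k else 1 := fun i => by
    by_cases h : i.1 = n + 1 <;> simp [b, h]
  have hd : ∀ i : Fin (n + 3), (d i : ℝ) = if i.1 = 1 then δ else 1 := fun i => by
    by_cases h : i.1 = 1 <;> simp [d, h]
  have hb : ∀ i, 0 < (b i : ℝ) := fun i => by
    rw [hb' i]; split_ifs <;> positivity
  have hv := ruin_isValue (E := E) hs hk hδ hb hb' hd
  refine ⟨ruinProtocol s₁ s₂ n b d, ?_⟩
  have h := receiverPayoffs_eq_singleton hp0 hp1 (v := fun θ i =>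
    (∑ j ∈ Finset.range i.1, ruinStep (E.prob θ s₁ / E.prob θ s₂) k δ n j)
        / ruinSum (E.prob θ s₁ / E.prob θ s₂) k δ n) hv (ruin_escapes hb Nature.L)
    fun i hi => ruinProtocol_absorbing hi
  rw [h]
  have hg : ∀ u : Fin (n + 3) → ℝ, ∑ i, (ruinProtocol s₁ s₂ n b d).g.1 i * u i = u 1 := fun u => by
    simp [ruinProtocol, Pi.single_apply]
  rw [hg, hg]
  simp [ruinStep]

/-- The optimal odds. -/
theorem exists_optimal_odds {p G : ℝ} (hp0 : 0 < p) (hp1 : p < 1) (hG : skewness p < G) :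
    ∃ z, 0 < z ∧ p * (1 / (1 + z)) + (1 - p) * (1 - 1 / (1 + G * z))
      = 1 - (2 * √(p * (1 - p) * G) - 1) / (G - 1) := by
  have hG1 := (skewness_ge_one hp0 hp1).trans_lt hG
  obtain ⟨h1, h2⟩ := (skewness_lt_iff hp0 hp1).1 hG
  have hG0 : 0 < G - 1 := sub_pos.2 hG1
  have hpos : 0 ≤ p * (1 - p) * G :=
    mul_nonneg (mul_pos hp0 (sub_pos.2 hp1)).le (by linarith)
  have hr2 : √(p * (1 - p) * G) ^ 2 = p * (1 - p) * G := Real.sq_sqrt hpos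
  have hr1 : p < √(p * (1 - p) * G) := by
    refine Real.lt_sqrt_of_sq_lt ?_
    nlinarith
  have hr3 : √(p * (1 - p) * G) < G * p := by
    refine (Real.sqrt_lt' (mul_pos (by linarith) hp0)).2 ?_
    nlinarith [mul_pos (mul_pos (show 0 < G by linarith) hp0) (sub_pos.2 h2)]
  set r := √(p * (1 - p) * G)
  have ha := sub_pos.2 hr1
  have hb := sub_pos.2 hr3
  have hr0 : 0 < r := hp0.trans hr1
  -- The solution of `p * (1 + G * z) = r * (1 + z)`, the equality case of AM-GM in `two_sqrt_le`
  -- with `x = 1 / (1 + z)` and `y = 1 / (1 + G * z)`.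
  refine ⟨(r - p) / (G * p - r), div_pos ha hb, ?_⟩
  have e1 : 1 + (r - p) / (G * p - r) = p * (G - 1) / (G * p - r) := by
    rw [eq_div_iff hb.ne', add_mul, div_mul_cancel₀ _ hb.ne']; ring
  have e2 : 1 + G * ((r - p) / (G * p - r)) = r * (G - 1) / (G * p - r) := by
    rw [eq_div_iff hb.ne', add_mul, mul_assoc, div_mul_cancel₀ _ hb.ne']; ring
  rw [e1, e2]
  field_simp
  linear_combination hr2

theorem exists_constant_payoff (E : Experiment S) {p : ℝ} (hp0 : 0 < p) (hp1 : p < 1) (n : ℕ) :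
    ∃ P : Protocol S (Fin (n + 1)), receiverPayoffs E p P = {max p (1 - p)} := by
  classical
  have key : ∀ x : unitInterval, ∃ P : Protocol S (Fin (n + 1)),
      receiverPayoffs E p P = {p * x + (1 - p) * (1 - x)} := by
    intro x
    let P : Protocol S (Fin (n + 1)) :=
      -- All states are absorbing, so the game ends at once.
      { f := fun i _ => moveTo 0 i i
        g := ⟨Pi.single 0 1, single_mem_stdSimplex ℝ 0⟩
        a := fun _ => x }
    have hesc : ∀ θ, Escapes (transition E P θ) Set.univ := fun θ T hT hTD => by
      rw [Set.disjoint_univ] at hTD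
      exact absurd hTD hT.ne_empty
    have hv : ∀ θ, IsValue (transition E P θ) (fun i => (P.a i : ℝ)) (fun _ => (x : ℝ)) := fun θ =>
      ⟨fun i => le_rfl, fun i => by rw [← Finset.sum_mul, transition_sum, one_mul],
        fun i h => absurd rfl h, (hesc θ).mono fun i _ => rfl⟩
    refine ⟨P, ?_⟩
    rw [receiverPayoffs_eq_singleton hp0 hp1 (v := fun _ _ => (x : ℝ)) hv (hesc Nature.L)
      fun i _ s => by simp [P, moveTo], ← Finset.sum_mul, P.g.2.2, one_mul]
  rcases max_choice p (1 - p) with h | h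
  · obtain ⟨P, hP⟩ := key 1
    exact ⟨P, by rw [hP, h]; simp⟩
  · obtain ⟨P, hP⟩ := key 0
    exact ⟨P, by rw [hP, h]; simp⟩

/-- Payoffs that do not depend on the choice of a best response come arbitrarily close to the
optimum. -/
theorem optimalPayoff_le_of_forall (E : Experiment S) {p : ℝ} (hp0 : 0 < p) (hp1 : p < 1) {m : ℕ}
    (hm : 2 ≤ m) {b : ℝ}
    (hb : ∀ (P : Protocol S (Fin m)) (u : ℝ), receiverPayoffs E p P = {u} → u ≤ b) :
    optimalPayoff p E.gamma m ≤ b := by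
  unfold optimalPayoff
  split_ifs with hG
  · obtain ⟨s₁, s₂, -, -, hγ⟩ := E.exists_extreme
    obtain ⟨z, hz, hzV⟩ := exists_optimal_odds hp0 hp1 hG
    have hone := skewness_ge_one hp0 hp1
    have hs : s₁ ≠ s₂ := by
      rintro rfl
      rw [hγ, div_self (E.ratio_pos s₁).ne', one_pow] at hG
      linarith
    -- For `m = 2` the power of `γ` is `1`, which does not exceed the skewness; so there is an
    -- interior state.
    obtain ⟨n, rfl⟩ : ∃ n, m = n + 3 := by
      refine ⟨m - 3, ?_⟩
      by_contra h
      have : m - 2 = 0 := by omega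
      rw [this, pow_zero] at hG
      linarith
    have hn : n + 3 - 2 = n + 1 := rfl
    rw [hn] at hzV ⊢
    set ρH := E.prob Nature.H s₁ / E.prob Nature.H s₂ with hρH
    set ρL := E.prob Nature.L s₁ / E.prob Nature.L s₂ with hρL
    have hρH0 : 0 < ρH := div_pos (E.prob_pos _ _) (E.prob_pos _ _)
    have hρ : ρL = E.gamma * ρH := by
      have a1 := (E.prob_pos Nature.H s₁).ne'
      have a2 := (E.prob_pos Nature.H s₂).ne'
      have a3 := (E.prob_pos Nature.L s₁).ne'
      have a4 := (E.prob_pos Nature.L s₂).ne'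
      rw [hγ, hρH, hρL, Experiment.ratio, Experiment.ratio]
      field_simp
    -- This `k` makes the limiting odds against `H` equal to `z` in state `H`, hence `γ ^ (n + 1) *
    -- z` in state `L`.
    have hk : 0 < ρH ^ (n + 1) / z := div_pos (pow_pos hρH0 _) hz
    set k := ρH ^ (n + 1) / z with hkdef
    have hkH : ρH ^ (n + 1) / k = z := by rw [hkdef]; field_simp
    have hkL : ρL ^ (n + 1) / k = E.gamma ^ (n + 1) * z := by
      rw [hρ, mul_pow, mul_div_assoc, hkH]
    have hγ0 : 0 < E.gamma := zero_lt_one.trans_le E.one_le_gamma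
    have tH := tendsto_ruinSum ρH k n
    have tL := tendsto_ruinSum ρL k n
    rw [hkH] at tH
    rw [hkL] at tL
    have t := ((tendsto_const_nhds (x := (1 : ℝ)).div tH (by positivity)).const_mul p).add
      (((tendsto_const_nhds (x := (1 : ℝ)).sub
        (tendsto_const_nhds (x := (1 : ℝ)).div tL (by positivity)))).const_mul (1 - p))
    rw [hzV] at t
    refine le_of_tendsto t ?_
    -- Below this threshold `δ` and `δ * k` are probabilities.
    have hsmall : Set.Ioo (0 : ℝ) (min 1 (1 / k)) ∈ 𝓝[>] (0 : ℝ) :=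
      Ioo_mem_nhdsGT (lt_min one_pos (one_div_pos.2 hk))
    filter_upwards [hsmall] with δ hδ
    obtain ⟨P, hP⟩ := exists_ruin_payoff (E := E) hs n hp0 hp1 hk hδ.1
      (hδ.2.le.trans (min_le_left _ _)) ((le_div_iff₀ hk).1 (hδ.2.le.trans (min_le_right _ _)))
    exact hb P _ hP
  · obtain ⟨n, rfl⟩ : ∃ n, m = n + 1 := ⟨m - 1, by omega⟩
    obtain ⟨P, hP⟩ := exists_constant_payoff E hp0 hp1 n
    exact hb P _ hP

end Construction

end StrategicMemory

/-! ### The main theorem -/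

theorem mainTheorem2 {S : Type*} [Fintype S] (E : StrategicMemory.Experiment S)
    (p : ℝ) (hp0 : 0 < p) (hp1 : p < 1) (m : ℕ) (hm : 2 ≤ m) :
    -- every protocol has a best response
    (∀ P : StrategicMemory.Protocol S (Fin m),
      (StrategicMemory.bestResponses E p P).Nonempty) ∧
    -- the value of `sup_P sup_{σ ∈ br P}`
    IsLUB {u : ℝ | ∃ P : StrategicMemory.Protocol S (Fin m),
        IsLUB (StrategicMemory.receiverPayoffs E p P) u}
      (StrategicMemory.optimalPayoff p E.gamma m) ∧
    -- the value of `sup_P inf_{σ ∈ br P}`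
    IsLUB {u : ℝ | ∃ P : StrategicMemory.Protocol S (Fin m),
        IsGLB (StrategicMemory.receiverPayoffs E p P) u}
      (StrategicMemory.optimalPayoff p E.gamma m) ∧
    -- no protocol attains the value, whichever best responses the sender plays
    (4 ≤ m → E.gamma ^ (m - 2) > StrategicMemory.skewness p →
      ∀ P : StrategicMemory.Protocol S (Fin m),
        ¬ IsLUB (StrategicMemory.receiverPayoffs E p P)
            (StrategicMemory.optimalPayoff p E.gamma m) ∧
        ¬ IsGLB (StrategicMemory.receiverPayoffs E p P)
            (StrategicMemory.optimalPayoff p E.gamma m) ∧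
        StrategicMemory.optimalPayoff p E.gamma m ∉
            StrategicMemory.receiverPayoffs E p P) := by
  have hle : ∀ (P : StrategicMemory.Protocol S (Fin m)),
      ∀ σ ∈ StrategicMemory.bestResponses E p P,
        StrategicMemory.receiverPayoff E p P σ ≤ StrategicMemory.optimalPayoff p E.gamma m := by
    intro P σ hσ
    simpa using StrategicMemory.receiverPayoff_le_optimalPayoff hp0 hp1 hσ
  have hne : ∀ P : StrategicMemory.Protocol S (Fin m),
      (StrategicMemory.bestResponses E p P).Nonempty := fun P =>
    StrategicMemory.bestResponses_nonempty E P hp0 hp1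
  refine ⟨hne, ⟨?_, fun b hb => ?_⟩, ⟨?_, fun b hb => ?_⟩, fun hm4 hG P => ?_⟩
  · rintro u ⟨P, hP⟩
    refine hP.2 ?_
    rintro _ ⟨σ, hσ, rfl⟩
    exact hle P σ hσ
  -- The approximating protocols have a single best-response payoff, so they serve for the supremum
  -- and for the infimum alike.
  · refine StrategicMemory.optimalPayoff_le_of_forall E hp0 hp1 hm fun P u hP => hb ⟨P, ?_⟩
    rw [hP]
    exact isLUB_singleton
  · rintro u ⟨P, hP⟩
    obtain ⟨σ, hσ⟩ := hne P
    exact (hP.1 ⟨σ, hσ, rfl⟩).trans (hle P σ hσ)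
  · refine StrategicMemory.optimalPayoff_le_of_forall E hp0 hp1 hm fun P u hP => hb ⟨P, ?_⟩
    rw [hP]
    exact isGLB_singleton
  · obtain ⟨b, hb, hle⟩ := StrategicMemory.exists_receiverPayoff_le_lt (E := E) P hp0 hp1
      (by simpa using hm4) (by simpa using hG)
    rw [Fintype.card_fin] at hb
    refine ⟨fun h => ?_, fun h => ?_, ?_⟩
    · refine absurd (h.2 ?_) (not_le.2 hb)
      rintro _ ⟨σ, hσ, rfl⟩
      exact hle σ hσ
    · obtain ⟨σ, hσ⟩ := hne P
      exact absurd ((h.1 ⟨σ, hσ, rfl⟩).trans (hle σ hσ)) (not_le.2 hb)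
    · rintro ⟨σ, hσ, h⟩
      exact absurd (h ▸ hle σ hσ) (not_le.2 hb)
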